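/- Let $(X,d)$ be a complete separable metric space and let $E:X\to\mathbb R\cup\{+\infty\}$ be lower semicontinuous, with dense domain $D(E)=\{E<\infty\}$, and bounded from below on every $d$-bounded set. Assume that there is $\lambda\in\mathbb R$ such that for every $z\in X$ there is an $\mathrm{EVI}_\lambda$-gradient flow of $E$ starting at $z$, i.e. a curve $\gamma:(0,\infty)\to X$, absolutely continuous on compact subintervals of $(0,\infty)$, with $\gamma_t\to z$ as $t\downarrow0$ and $$\frac12\frac{d}{dt}d^2(\gamma_t,w)+\frac\lambda2 d^2(\gamma_t,w)+E(\gamma_t)\le E(w)\qquad\text{for all } w\in X \text{ and a.e. } t>0 .$$ Let $|\partial E|(z)=\limsup_{w\to z,\,w\ne z}\frac{[E(z)-E(w)]^+}{d(z,w)}$ for $z\in D(E)$ (equal to $0$ if $z\in D(E)$ is isolated) and $|\partial E|(z)=+\infty$ for $z\notin D(E)$. For $\gamma\in C([0,1],X)$ and $\varepsilon>0$ put $$\mathcal A(\gamma)=\frac12\int_0^1|\dot\gamma_t|^2\,dt,\qquad \mathcal I(\gamma)=\frac12\int_0^1|\partial E|^2(\gamma_t)\,dt,\qquad \mathcal A_\varepsilon=\mathcal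 A+\varepsilon^2\mathcal I ,$$ where $|\dot\gamma_t|$ is the metric speed and $\mathcal A(\gamma)=+\infty$ if $\gamma$ is not absolutely continuous. Given $x,y\in X$, let $\iota_{01}(\gamma)=0$ if $\gamma_0=x$ and $\gamma_1=y$, and $\iota_{01}(\gamma)=+\infty$ otherwise. If $E(x)<\infty$ and $E(y)<\infty$, then, as $\varepsilon\downarrow0$, the functionals $\mathcal A_\varepsilon+\iota_{01}$ $\Gamma$-converge to $\mathcal A+\iota_{01}$ on $C([0,1],X)$ with respect to uniform convergence; that is: 1. for all $\varepsilon_n>0$ with $\varepsilon_n\to0$ and all $\gamma^n\to\gamma$, one has $(\mathcal A+\iota_{01})(\gamma)\le\liminf_{n\to\infty}(\mathcal A_{\varepsilon_n}+\iota_{01})(\gamma^n)$; 2. for every $\gamma\in C([0,1],X)$ there are curves $\gamma^\varepsilon\in C([0,1],X)$, $\varepsilon>0$, with $\gamma^\varepsilon\to\gamma$ as $\varepsilon\downarrow0$ and $\limsup_{\varepsilon\downarrow0}(\mathcal A_\varepsilon+\iota_{01})(\gamma^\varepsilon)\le(\mathcal A+\iota_{01})(\gamma)$. Moreover, let $\sigma$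 be any Hausdorff topology on $X$ such that every $d$-bounded sequence has a $\sigma$-convergent subsequence and such that $d:X\times X\to[0,\infty)$ and $|\partial E|:X\to[0,\infty]$ are sequentially $\sigma$-lower semicontinuous. Then the same $\Gamma$-convergence, in the sense of 1 and 2, holds on $C([0,1],X)$ with uniform convergence replaced by pointwise-in-time $\sigma$-convergence ($\gamma^n_t\to\gamma_t$ in $\sigma$ for every $t\in[0,1]$). -/

import Mathlib

open Filter Topology MeasureTheory
open scoped ENNReal

noncomputable section

namespace SchrodingerGamma

open Classical in
/-- Descending slope of `E : X → ℝ ∪ {+∞}` (values in `EReal`): `+∞` off the domain of `E`, and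
`limsup_{y → x, y ≠ x} [E x - E y]⁺ / d(x, y)` on it. `EReal.toENNReal` is the positive part. At an
isolated point the punctured neighbourhood filter is `⊥` and the `limsup` in `[0, ∞]` is `0`. -/
def metricSlope {X : Type*} [MetricSpace X] (E : X → EReal) (x : X) : ℝ≥0∞ :=
  if E x = ⊤ then ⊤
  else limsup (fun y => (E x - E y).toENNReal / edist x y) (𝓝[≠] x)

/-- `γ`, restricted to `(0, ∞)`, is an `EVI_lam` gradient flow of `E` starting at `x`: it is locally
absolutely continuous in `(0, ∞)`, satisfies for every `y` and almost every `t > 0`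
`(1/2) d/dt d²(γ_t, y) + (lam/2) d²(γ_t, y) + E(γ_t) ≤ E(y)`, and tends to `x` as `t ↓ 0`.
(The derivative exists for almost every `t > 0` by local absolute continuity.) -/
structure IsEVIFlowFrom {X : Type*} [MetricSpace X] (E : X → EReal) (lam : ℝ) (γ : ℝ → X)
    (x : X) : Prop where
  locallyAC : ∀ a b : ℝ, 0 < a → a ≤ b → AbsolutelyContinuousOnInterval γ a b
  evi : ∀ y : X, ∀ᵐ t ∂(volume.restrict (Set.Ioi (0 : ℝ))),
    ((1 / 2 * deriv (fun s => dist (γ s) y ^ 2) t + lam / 2 * dist (γ t) y ^ 2 : ℝ) : EReal)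
      + E (γ t) ≤ E y
  start : Tendsto γ (𝓝[>] 0) (𝓝 x)

/-- Completeness and separability of `X` are type class assumptions of the theorem; the remaining
assumptions on the functional `E`. Boundedness from below on bounded sets (singletons, for instance)
excludes the value `-∞`, so that `E` takes values in `ℝ ∪ {+∞}`. -/
structure IsAdmissible {X : Type*} [MetricSpace X] (E : X → EReal) : Prop where
  lsc : LowerSemicontinuous E
  dense_domain : Dense {x | E x < ⊤}
  bddBelow : ∀ B : Set X, Bornology.IsBounded B → ∃ c : ℝ, ∀ x ∈ B, (c : EReal) ≤ E x
  exists_flow : ∃ lam : ℝ, ∀ x : X, ∃ γ : ℝ → X, IsEVIFlowFrom E lam γ x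

/-- The extra hypothesis on an auxiliary topology `σ` on `X`: it is Hausdorff, bounded sets are
relatively sequentially `σ`-compact, and the distance (as a function of two variables) and the slope
of `E` are sequentially `σ`-lower semicontinuous. -/
structure IsCompatible {X : Type*} [MetricSpace X] (E : X → EReal) (σ : TopologicalSpace X) :
    Prop where
  hausdorff : @T2Space X σ
  seqCompact : ∀ u : ℕ → X, Bornology.IsBounded (Set.range u) →
    ∃ (z : X) (φ : ℕ → ℕ), StrictMono φ ∧ Tendsto (u ∘ φ) atTop (@nhds X σ z)
  dist_lsc : ∀ (u v : ℕ → X) (a b : X), Tendsto u atTop (@nhds X σ a) →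
    Tendsto v atTop (@nhds X σ b) → edist a b ≤ liminf (fun n => edist (u n) (v n)) atTop
  slope_lsc : ∀ (u : ℕ → X) (a : X), Tendsto u atTop (@nhds X σ a) →
    metricSlope E a ≤ liminf (fun n => metricSlope E (u n)) atTop

/-- Metric speed `lim_{s → t} d(γ_s, γ_t) / |s - t|`, written with a `limsup`; the limit exists for
almost every `t` when `γ` is absolutely continuous. -/
def metricSpeed {X : Type*} [MetricSpace X] (γ : ℝ → X) (t : ℝ) : ℝ≥0∞ :=
  limsup (fun s => edist (γ s) (γ t) / edist s t) (𝓝[≠] t)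

/-- The space `C([0,1], X)` of curves that are continuous for the metric topology of `X` (the name
fixes that topology also where another topology `σ` on `X` is in the context). -/
abbrev Curve (X : Type*) [MetricSpace X] : Type _ := C(unitInterval, X)

/-- A continuous curve on `[0, 1]` as a function on `ℝ` (constant to the left of `0` and to the right
of `1`). -/
def curveExtend {X : Type*} [MetricSpace X] (γ : Curve X) : ℝ → X :=
  Set.IccExtend (zero_le_one (α := ℝ)) γ

open Classical in
/-- Kinetic action `𝒜(γ) = (1/2) ∫₀¹ |γ̇_t|² dt`, and `+∞` if `γ` is not absolutely continuous. -/
def kineticAction {X : Type*} [MetricSpace X] (γ : Curve X) : ℝ≥0∞ :=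
  if AbsolutelyContinuousOnInterval (curveExtend γ) 0 1 then
    1 / 2 * ∫⁻ t in Set.Icc (0 : ℝ) 1, metricSpeed (curveExtend γ) t ^ 2
  else ⊤

/-- Halved Fisher information `ℐ(γ) = (1/2) ∫₀¹ |∂E|²(γ_t) dt`. -/
def fisherInformation {X : Type*} [MetricSpace X] (E : X → EReal) (γ : Curve X) :
    ℝ≥0∞ :=
  1 / 2 * ∫⁻ t in Set.Icc (0 : ℝ) 1, metricSlope E (curveExtend γ t) ^ 2

/-- The functional `𝒜_ε = 𝒜 + ε² ℐ`. -/
def schrodingerAction {X : Type*} [MetricSpace X] (E : X → EReal) (ε : ℝ)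
    (γ : Curve X) : ℝ≥0∞ :=
  kineticAction γ + ENNReal.ofReal (ε ^ 2) * fisherInformation E γ

open Classical in
/-- Convex indicator `ι₀₁` of the endpoint constraints `γ_0 = x`, `γ_1 = y`. -/
def endpointIndicator {X : Type*} [MetricSpace X] (x y : X) (γ : Curve X) : ℝ≥0∞ :=
  if γ 0 = x ∧ γ 1 = y then 0 else ⊤

/-- (Sequential) `Γ`-convergence of `F ε` to `G` as `ε ↓ 0` for the convergence of a topology `τ`:
the liminf inequality along all sequences `ε_n ↓ 0` and all `γ_n → γ`, and for every `γ` a recovery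
family `γ^ε → γ` as `ε ↓ 0` (which in particular is a recovery sequence along each `ε_n ↓ 0`). -/
structure GammaConverges {Y : Type*} (τ : TopologicalSpace Y) (F : ℝ → Y → ℝ≥0∞) (G : Y → ℝ≥0∞) :
    Prop where
  liminf_le : ∀ (ε : ℕ → ℝ) (γs : ℕ → Y) (γ : Y), (∀ n, 0 < ε n) → Tendsto ε atTop (𝓝 0) →
    Tendsto γs atTop (@nhds Y τ γ) → G γ ≤ liminf (fun n => F (ε n) (γs n)) atTop
  recovery : ∀ γ : Y, ∃ γs : ℝ → Y, Tendsto γs (𝓝[>] 0) (@nhds Y τ γ) ∧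
    limsup (fun ε => F ε (γs ε)) (𝓝[>] 0) ≤ G γ

/-- Topology of uniform convergence on `C([0,1], X)`; on the compact interval it is Mathlib's
topology on `C(unitInterval, X)`. -/
@[reducible]
def uniformTopology (X : Type*) [MetricSpace X] : TopologicalSpace (Curve X) :=
  inferInstance

theorem tendsto_uniformTopology_iff {X : Type*} [MetricSpace X] {ι : Type*} {l : Filter ι}
    {γs : ι → Curve X} {γ : Curve X} :
    Tendsto γs l (@nhds _ (uniformTopology X) γ) ↔ TendstoUniformly (fun i t => γs i t) γ l :=
  ContinuousMap.tendsto_iff_tendstoUniformly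

/-- Topology of pointwise-in-time `σ`-convergence on the `d`-continuous curves: the one induced from
the product topology on `[0, 1] → (X, σ)`. -/
@[reducible]
def pointwiseTopology {X : Type*} [MetricSpace X] (σ : TopologicalSpace X) :
    TopologicalSpace (Curve X) :=
  TopologicalSpace.induced (fun γ t => γ t) (@Pi.topologicalSpace unitInterval (fun _ => X) fun _ => σ)

theorem tendsto_pointwiseTopology_iff {X : Type*} [MetricSpace X] (σ : TopologicalSpace X)
    {ι : Type*} {l : Filter ι} {γs : ι → Curve X} {γ : Curve X} :
    Tendsto γs l (@nhds _ (pointwiseTopology σ) γ) ↔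
      ∀ t, Tendsto (fun i => γs i t) l (@nhds X σ (γ t)) := by
  rw [pointwiseTopology, nhds_induced, tendsto_comap_iff]
  exact @tendsto_pi_nhds ι unitInterval (fun _ => X) (fun _ => σ) _ _ _

end SchrodingerGamma

end

/-!
Averaging the EVI over time gives an inequality in integrated form, with parameter `-κ`,
`κ = |lam|`, and without derivatives. It implies that two flows satisfy
`d (u t, v t) ≤ exp (κ t) * d (u 0, v 0)`, and that a flow dissipates energy at a rate of at least
the square of the slope, up to a factor of order `exp (-κ t)`.

To regularize a curve `γ`, let `γ t` evolve for time `τ * min t (1 - t)`, so that the end points do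
not move. For two nearby parameters at a distance `Δ`, the two flows run for times which differ by
`τ * Δ`, and the contraction, the EVI and the energy dissipation together bound
`d² + (τ / 2)² * slope² * Δ²` by `Δ` times the increment of a control function. With `τ = 2 * ε`,
dividing by `Δ²` shows that `speed² + ε² * slope²` is at most the derivative of the control. The
control is monotone, so its total increment bounds the integral; this increment consists of the
action of `γ`, up to factors `exp (c * τ)`, and of an energy difference multiplied by `τ`.

Conversely, a finite action amounts to a bound `d (γ s, γ t)² ≤ (t - s) * (w t - w s)`. Such bounds
pass to limits along which `d` is lower semicontinuous, and this gives the liminf inequality.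
-/

noncomputable section

namespace SchrodingerGamma

open Set

/-! ### Energy bounds and the metric speed -/

section EnergyBound

variable {X : Type*} [MetricSpace X] {γ : ℝ → X} {w : ℝ → ℝ} {a b : ℝ}

lemma sum_sub_le_of_pairwiseDisjoint_Ioc {ι : Type*} (hab : a ≤ b)
    (hw : MonotoneOn w (Icc a b)) (s : Finset ι) (p q : ι → ℝ)
    (hp : ∀ i ∈ s, a ≤ p i) (hpq : ∀ i ∈ s, p i ≤ q i) (hq : ∀ i ∈ s, q i ≤ b)
    (hd : (s : Set ι).PairwiseDisjoint fun i => Ioc (p i) (q i)) :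
    ∑ i ∈ s, (w (q i) - w (p i)) ≤ w b - w a := by
  classical
  suffices H : ∀ c ∈ Icc a b, (∀ i ∈ s, q i ≤ c) → ∑ i ∈ s, (w (q i) - w (p i)) ≤ w c - w a from
    H b ⟨hab, le_rfl⟩ hq
  clear hq
  induction s using Finset.induction_on_max_value p with
  | empty =>
    intro c hc _
    simpa using hw ⟨le_rfl, hab⟩ hc hc.1
  | insert i s his hmax ih =>
    intro c hc hqc
    have ih' := ih (fun j hj => hp j (Finset.mem_insert_of_mem hj))
      (fun j hj => hpq j (Finset.mem_insert_of_mem hj)) (hd.subset (by simp))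
    have hi := Finset.mem_insert_self i s
    rw [Finset.sum_insert his]
    rcases (hpq i hi).eq_or_lt with h | h
    · rw [h, sub_self, zero_add]
      exact ih' c hc fun j hj => hqc j (Finset.mem_insert_of_mem hj)
    have hqp : ∀ j ∈ s, q j ≤ p i := by
      intro j hj
      by_contra! hlt
      have hij : i ≠ j := fun h => his (h ▸ hj)
      refine Set.disjoint_left.1 (hd (by simp) (by simp [hj]) hij)
        (show min (q i) (q j) ∈ _ from ⟨lt_min h hlt, min_le_left _ _⟩)
        ⟨lt_min ((hmax j hj).trans_lt h) ((hmax j hj).trans_lt hlt), min_le_right _ _⟩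
    have hsum := ih' (p i) ⟨hp i hi, (hpq i hi).trans ((hqc i hi).trans hc.2)⟩ hqp
    have hlast : w (q i) ≤ w c :=
      hw ⟨(hp i hi).trans h.le, (hqc i hi).trans hc.2⟩ hc (hqc i hi)
    linarith

/-- On `S` the increments of `w` dominate the kinetic energy of `γ`. For an absolutely continuous
`γ` the smallest such `w` is a primitive of the squared metric speed, but this integral form is
stable under limits of `γ` and `w`. -/
def HasEnergyBound (γ : ℝ → X) (w : ℝ → ℝ) (S : Set ℝ) : Prop :=
  ∀ s ∈ S, ∀ t ∈ S, s ≤ t → dist (γ s) (γ t) ^ 2 ≤ (t - s) * (w t - w s)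

namespace HasEnergyBound

lemma monotoneOn {S : Set ℝ} (h : HasEnergyBound γ w S) : MonotoneOn w S := by
  intro s hs t ht hst
  rcases hst.eq_or_lt with rfl | hlt
  · rfl
  · exact sub_nonneg.1 (nonneg_of_mul_nonneg_right ((sq_nonneg _).trans (h s hs t ht hst))
      (sub_pos.2 hlt))

/-- The concatenation is controlled by `x² / α + y² / β ≥ (x + y)² / (α + β)`. -/
lemma union_Icc {c : ℝ} (h₁ : HasEnergyBound γ w (Icc a b)) (h₂ : HasEnergyBound γ w (Icc b c)) :
    HasEnergyBound γ w (Icc a c) := by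
  intro s hs t ht hst
  rcases le_total t b with htb | hbt
  · exact h₁ s ⟨hs.1, hst.trans htb⟩ t ⟨ht.1, htb⟩ hst
  rcases le_total b s with hbs | hsb
  · exact h₂ s ⟨hbs, hs.2⟩ t ⟨hbt, ht.2⟩ hst
  have hs' : s ∈ Icc a b := ⟨hs.1, hsb⟩
  have ht' : t ∈ Icc b c := ⟨hbt, ht.2⟩
  have hb₁ : b ∈ Icc a b := ⟨hs.1.trans hsb, le_rfl⟩
  have hb₂ : b ∈ Icc b c := ⟨le_rfl, hbt.trans ht.2⟩
  have hsum := Finset.sum_sq_le_sum_mul_sum_of_sq_le_mul Finset.univ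
    (r := ![dist (γ s) (γ b), dist (γ b) (γ t)]) (f := ![b - s, t - b])
    (g := ![w b - w s, w t - w b]) (by simp [hsb, hbt])
    (by simp [h₁.monotoneOn hs' hb₁ hsb, h₂.monotoneOn hb₂ ht' hbt])
    (by simp [h₁ s hs' b hb₁ hsb, h₂ b hb₂ t ht' hbt])
  simp only [Fin.sum_univ_two, Matrix.cons_val_zero, Matrix.cons_val_one] at hsum
  calc dist (γ s) (γ t) ^ 2 ≤ (dist (γ s) (γ b) + dist (γ b) (γ t)) ^ 2 := by
        gcongr; exact dist_triangle _ _ _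
    _ ≤ _ := hsum
    _ = (t - s) * (w t - w s) := by ring

lemma sum_dist_sq_le {ι : Type*} (h : HasEnergyBound γ w (Icc a b)) (hab : a ≤ b)
    (s : Finset ι) (p q : ι → ℝ) (hp : ∀ i ∈ s, a ≤ p i) (hpq : ∀ i ∈ s, p i ≤ q i)
    (hq : ∀ i ∈ s, q i ≤ b) (hd : (s : Set ι).PairwiseDisjoint fun i => Ioc (p i) (q i)) :
    (∑ i ∈ s, dist (γ (p i)) (γ (q i))) ^ 2 ≤ (∑ i ∈ s, (q i - p i)) * (w b - w a) := by
  have hpI : ∀ i ∈ s, p i ∈ Icc a b := fun i hi => ⟨hp i hi, (hpq i hi).trans (hq i hi)⟩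
  have hqI : ∀ i ∈ s, q i ∈ Icc a b := fun i hi => ⟨(hp i hi).trans (hpq i hi), hq i hi⟩
  refine (Finset.sum_sq_le_sum_mul_sum_of_sq_le_mul s (fun i hi => sub_nonneg.2 (hpq i hi))
    (fun i hi => sub_nonneg.2 (h.monotoneOn (hpI i hi) (hqI i hi) (hpq i hi)))
    (fun i hi => h _ (hpI i hi) _ (hqI i hi) (hpq i hi))).trans ?_
  exact mul_le_mul_of_nonneg_left
    (sum_sub_le_of_pairwiseDisjoint_Ioc hab h.monotoneOn s p q hp hpq hq hd)
    (Finset.sum_nonneg fun i hi => sub_nonneg.2 (hpq i hi))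

lemma absolutelyContinuousOnInterval (h : HasEnergyBound γ w (Icc a b)) (hab : a ≤ b) :
    AbsolutelyContinuousOnInterval γ a b := by
  rw [absolutelyContinuousOnInterval_iff]
  intro ε hε
  set K := w b - w a + 1
  have hw : 0 ≤ w b - w a := sub_nonneg.2 (h.monotoneOn ⟨le_rfl, hab⟩ ⟨hab, le_rfl⟩ hab)
  have hK : 0 < K := by positivity
  refine ⟨ε ^ 2 / K, by positivity, fun I ⟨hI, hdisj⟩ hlen => ?_⟩
  rw [uIcc_of_le hab] at hI
  have hsq := h.sum_dist_sq_le hab (Finset.range I.1) (fun i => min (I.2 i).1 (I.2 i).2)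
    (fun i => max (I.2 i).1 (I.2 i).2) (fun i hi => le_min (hI i hi).1.1 (hI i hi).2.1)
    (fun i _ => min_le_max) (fun i hi => max_le (hI i hi).1.2 (hI i hi).2.2) hdisj
  have hdist : ∀ i, dist (γ (min (I.2 i).1 (I.2 i).2)) (γ (max (I.2 i).1 (I.2 i).2)) =
      dist (γ (I.2 i).1) (γ (I.2 i).2) := by
    intro i
    rcases le_total (I.2 i).1 (I.2 i).2 with h' | h'
    · rw [min_eq_left h', max_eq_right h']
    · rw [min_eq_right h', max_eq_left h', dist_comm]
  simp only [hdist, max_sub_min_eq_abs', ← Real.dist_eq] at hsq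
  refine lt_of_pow_lt_pow_left₀ 2 hε.le (hsq.trans_lt ?_)
  calc _ ≤ (∑ i ∈ Finset.range I.1, dist (I.2 i).1 (I.2 i).2) * K := by gcongr; linarith
    _ < ε ^ 2 / K * K := by gcongr
    _ = ε ^ 2 := div_mul_cancel₀ _ hK.ne'

lemma of_edist_le_liminf {ι : Type*} {l : Filter ι} [l.NeBot] {γs : ι → ℝ → X} {ws : ι → ℝ → ℝ}
    {S : Set ℝ} (h : ∀ i, HasEnergyBound (γs i) (ws i) S)
    (hw : ∀ t ∈ S, Tendsto (fun i => ws i t) l (𝓝 (w t)))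
    (hγ : ∀ s ∈ S, ∀ t ∈ S, edist (γ s) (γ t) ≤ liminf (fun i => edist (γs i s) (γs i t)) l) :
    HasEnergyBound γ w S := by
  intro s hs t ht hst
  have hlim : Tendsto (fun i => ENNReal.ofReal √((t - s) * (ws i t - ws i s))) l
      (𝓝 (ENNReal.ofReal √((t - s) * (w t - w s)))) :=
    ENNReal.tendsto_ofReal (((hw t ht).sub (hw s hs)).const_mul _).sqrt
  have hdist : edist (γ s) (γ t) ≤ ENNReal.ofReal √((t - s) * (w t - w s)) := by
    refine (hγ s hs t ht).trans ?_
    rw [← hlim.liminf_eq]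
    refine liminf_le_liminf (Eventually.of_forall fun i => ?_)
    rw [edist_dist]
    exact ENNReal.ofReal_le_ofReal (Real.le_sqrt_of_sq_le (h i s hs t ht hst))
  have hmono : w s ≤ w t := le_of_tendsto_of_tendsto' (hw s hs) (hw t ht) fun i =>
    (h i).monotoneOn hs ht hst
  rw [edist_dist, ENNReal.ofReal_le_ofReal_iff (Real.sqrt_nonneg _)] at hdist
  exact (Real.le_sqrt dist_nonneg (mul_nonneg (sub_nonneg.2 hst) (sub_nonneg.2 hmono))).1 hdist

end HasEnergyBound

lemma lintegral_le_of_le_deriv (hab : a ≤ b) (hw : MonotoneOn w (Icc a b)) {g : ℝ → ℝ≥0∞}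
    (hg : ∀ᵐ t : ℝ, t ∈ Ioo a b → DifferentiableAt ℝ w t → g t ≤ ENNReal.ofReal (deriv w t)) :
    ∫⁻ t in Icc a b, g t ≤ ENNReal.ofReal (w b - w a) := by
  have hw' : MonotoneOn w (uIcc a b) := by rwa [uIcc_of_le hab]
  have hint := hw'.intervalIntegrable_deriv
  have hmem := hw'.intervalIntegral_deriv_mem_uIcc
  rw [intervalIntegrable_iff_integrableOn_Ioo_of_le hab] at hint
  rw [uIcc_of_le (sub_nonneg.2 (hw ⟨le_rfl, hab⟩ ⟨hab, le_rfl⟩ hab)),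
    intervalIntegral.integral_of_le hab, integral_Ioc_eq_integral_Ioo] at hmem
  have hnn : 0 ≤ᵐ[volume.restrict (Ioo a b)] deriv w := by
    filter_upwards [ae_restrict_mem measurableSet_Ioo] with t ht
    rw [← derivWithin_of_mem_nhds (Icc_mem_nhds ht.1 ht.2)]
    exact hw.derivWithin_nonneg
  calc ∫⁻ t in Icc a b, g t = ∫⁻ t in Ioo a b, g t := setLIntegral_congr Ioo_ae_eq_Icc.symm
    _ ≤ ∫⁻ t in Ioo a b, ENNReal.ofReal (deriv w t) := by
        refine lintegral_mono_ae ?_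
        filter_upwards [ae_restrict_mem measurableSet_Ioo,
          ae_restrict_of_ae hw.ae_differentiableWithinAt_of_mem, ae_restrict_of_ae hg]
          with t ht hdiff hg
        exact hg ht
          ((hdiff (Ioo_subset_Icc_self ht)).differentiableAt (Icc_mem_nhds ht.1 ht.2))
    _ = ENNReal.ofReal (∫ t in Ioo a b, deriv w t) :=
        (ofReal_integral_eq_lintegral_ofReal hint hnn).symm
    _ ≤ ENNReal.ofReal (w b - w a) := ENNReal.ofReal_le_ofReal hmem.2

lemma edist_div_edist_eq (γ : ℝ → X) {s t : ℝ} (h : s ≠ t) :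
    edist (γ s) (γ t) / edist s t = ENNReal.ofReal (dist (γ s) (γ t) / |s - t|) := by
  rw [edist_dist, edist_dist, Real.dist_eq, ENNReal.ofReal_div_of_pos (abs_pos.2 (sub_ne_zero.2 h))]

lemma metricSpeed_sq_add_le {t c : ℝ} (hc : 0 ≤ c) (hw : DifferentiableAt ℝ w t)
    (h : ∀ᶠ s in 𝓝[≠] t, dist (γ s) (γ t) ^ 2 + c * (s - t) ^ 2 ≤ (s - t) * (w s - w t)) :
    metricSpeed γ t ^ 2 + ENNReal.ofReal c ≤ ENNReal.ofReal (deriv w t) := by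
  have hlim : Tendsto (fun s => slope w t s - c) (𝓝[≠] t) (𝓝 (deriv w t - c)) :=
    (hasDerivAt_iff_tendsto_slope.1 hw.hasDerivAt).sub tendsto_const_nhds
  have hquot : ∀ᶠ s in 𝓝[≠] t, (dist (γ s) (γ t) / |s - t|) ^ 2 ≤ slope w t s - c := by
    filter_upwards [h, self_mem_nhdsWithin] with s hs hne
    have h0 : s - t ≠ 0 := sub_ne_zero.2 hne
    have hslope : slope w t s = (s - t) * (w s - w t) / (s - t) ^ 2 := by
      rw [slope_def_field]
      field_simp
    rw [div_pow, sq_abs, hslope, le_sub_iff_add_le, div_add' _ _ _ (by positivity)]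
    gcongr
  have hnn : 0 ≤ deriv w t - c :=
    ge_of_tendsto hlim (hquot.mono fun s hs => (sq_nonneg _).trans hs)
  have hspeed : metricSpeed γ t ≤ ENNReal.ofReal √(deriv w t - c) := by
    rw [← (ENNReal.tendsto_ofReal hlim.sqrt).limsup_eq]
    refine limsup_le_limsup ?_
    filter_upwards [hquot, self_mem_nhdsWithin] with s hs hne
    rw [edist_div_edist_eq γ hne]
    exact ENNReal.ofReal_le_ofReal (Real.le_sqrt_of_sq_le hs)
  calc metricSpeed γ t ^ 2 + ENNReal.ofReal c
      ≤ ENNReal.ofReal √(deriv w t - c) ^ 2 + ENNReal.ofReal c := by gcongr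
    _ = ENNReal.ofReal (deriv w t) := by
      rw [← ENNReal.ofReal_pow (Real.sqrt_nonneg _), Real.sq_sqrt hnn, ← ENNReal.ofReal_add hnn hc,
        sub_add_cancel]

end EnergyBound

section AbsolutelyContinuous

variable {X : Type*} [MetricSpace X] {γ : ℝ → X} {a b : ℝ}

lemma absolutelyContinuousOnInterval_dist (h : AbsolutelyContinuousOnInterval γ a b) (z : X) :
    AbsolutelyContinuousOnInterval (fun t => dist (γ t) z) a b :=
  squeeze_zero (fun _ => Finset.sum_nonneg fun _ _ => dist_nonneg)
    (fun _ => Finset.sum_le_sum fun _ _ => abs_dist_sub_le _ _ _) h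

lemma absolutelyContinuousOnInterval_dist_sq (h : AbsolutelyContinuousOnInterval γ a b) (z : X) :
    AbsolutelyContinuousOnInterval (fun t => dist (γ t) z ^ 2) a b := by
  simp only [sq]
  exact (absolutelyContinuousOnInterval_dist h z).mul (absolutelyContinuousOnInterval_dist h z)

lemma enorm_deriv_dist_le_metricSpeed {z : X} {t : ℝ}
    (h : DifferentiableAt ℝ (fun s => dist (γ s) z) t) :
    ‖deriv (fun s => dist (γ s) z) t‖ₑ ≤ metricSpeed γ t := by
  rw [← (hasDerivAt_iff_tendsto_slope.1 h.hasDerivAt).enorm.limsup_eq]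
  refine limsup_le_limsup ?_
  filter_upwards [self_mem_nhdsWithin] with s hne
  rw [edist_div_edist_eq γ hne, ← ofReal_norm, slope_def_field, norm_div, Real.norm_eq_abs,
    Real.norm_eq_abs]
  gcongr
  exact abs_dist_sub_le _ _ _

lemma sq_lintegral_le_measure_mul_lintegral_sq {α : Type*} [MeasurableSpace α] (μ : Measure α)
    {f : α → ℝ≥0∞} (hf : AEMeasurable f μ) :
    (∫⁻ x, f x ∂μ) ^ 2 ≤ μ univ * ∫⁻ x, f x ^ 2 ∂μ := by
  have holder := ENNReal.lintegral_mul_le_Lp_mul_Lq μ Real.HolderConjugate.two_two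
    (f := fun _ => 1) aemeasurable_const hf
  simp only [Pi.mul_apply, one_mul, lintegral_const, ENNReal.rpow_two, one_pow] at holder
  calc (∫⁻ x, f x ∂μ) ^ 2
      ≤ (μ univ ^ (1 / 2 : ℝ) * (∫⁻ x, f x ^ 2 ∂μ) ^ (1 / 2 : ℝ)) ^ 2 := by gcongr
    _ = μ univ * ∫⁻ x, f x ^ 2 ∂μ := by
        rw [mul_pow, ← ENNReal.rpow_two, ← ENNReal.rpow_two, ← ENNReal.rpow_mul,
          ← ENNReal.rpow_mul]
        norm_num

lemma edist_le_lintegral_enorm_deriv_dist (h : AbsolutelyContinuousOnInterval γ a b)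
    (hab : a ≤ b) :
    edist (γ a) (γ b) ≤ ∫⁻ r in Ioc a b, ‖deriv (fun r => dist (γ r) (γ a)) r‖ₑ := by
  have hftc := (absolutelyContinuousOnInterval_dist h (γ a)).integral_deriv_eq_sub
  rw [dist_self, sub_zero, intervalIntegral.integral_of_le hab] at hftc
  rw [edist_dist, dist_comm, ← hftc]
  exact Real.ofReal_le_enorm _ |>.trans (enorm_integral_le_lintegral_enorm _)

lemma edist_sq_le_lintegral_metricSpeed_sq (h : AbsolutelyContinuousOnInterval γ a b)
    (hab : a ≤ b) :
    edist (γ a) (γ b) ^ 2 ≤ ENNReal.ofReal (b - a) * ∫⁻ r in Ioc a b, metricSpeed γ r ^ 2 := by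
  set f : ℝ → ℝ := fun r => dist (γ r) (γ a)
  have hf : AbsolutelyContinuousOnInterval f a b := absolutelyContinuousOnInterval_dist h (γ a)
  have hint := hf.intervalIntegrable_deriv
  rw [intervalIntegrable_iff_integrableOn_Ioc_of_le hab] at hint
  calc edist (γ a) (γ b) ^ 2 ≤ (∫⁻ r in Ioc a b, ‖deriv f r‖ₑ) ^ 2 := by
        gcongr; exact edist_le_lintegral_enorm_deriv_dist h hab
    _ ≤ ENNReal.ofReal (b - a) * ∫⁻ r in Ioc a b, ‖deriv f r‖ₑ ^ 2 := by
        simpa only [Measure.restrict_apply_univ, Real.volume_Ioc] using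
          sq_lintegral_le_measure_mul_lintegral_sq _ hint.aestronglyMeasurable.enorm
    _ ≤ ENNReal.ofReal (b - a) * ∫⁻ r in Ioc a b, metricSpeed γ r ^ 2 := by
        gcongr ENNReal.ofReal (b - a) * ?_
        refine lintegral_mono_ae ?_
        filter_upwards [ae_restrict_mem measurableSet_Ioc,
          ae_restrict_of_ae hf.ae_differentiableAt] with r hr hd
        rw [uIcc_of_le hab] at hd
        gcongr
        exact enorm_deriv_dist_le_metricSpeed (hd (Ioc_subset_Icc_self hr))

lemma hasEnergyBound_lintegral_metricSpeed_sq (h : AbsolutelyContinuousOnInterval γ a b)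
    (hfin : ∫⁻ r in Ioc a b, metricSpeed γ r ^ 2 ≠ ⊤) :
    HasEnergyBound γ (fun t => (∫⁻ r in Ioc a t, metricSpeed γ r ^ 2).toReal) (Icc a b) := by
  intro s hs t ht hst
  have hfin' : ∀ p q, a ≤ p → q ≤ b → ∫⁻ r in Ioc p q, metricSpeed γ r ^ 2 ≠ ⊤ :=
    fun p q hp hq => ne_top_of_le_ne_top hfin (lintegral_mono_set (Ioc_subset_Ioc hp hq))
  have hsub : (∫⁻ r in Ioc a t, metricSpeed γ r ^ 2).toReal -
      (∫⁻ r in Ioc a s, metricSpeed γ r ^ 2).toReal =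
        (∫⁻ r in Ioc s t, metricSpeed γ r ^ 2).toReal := by
    rw [← Ioc_union_Ioc_eq_Ioc hs.1 hst, lintegral_union measurableSet_Ioc
      (Ioc_disjoint_Ioc_of_le le_rfl), ENNReal.toReal_add (hfin' _ _ le_rfl hs.2)
      (hfin' _ _ hs.1 ht.2), add_sub_cancel_left]
  have hac : AbsolutelyContinuousOnInterval γ s t := h.mono <| by
    rw [uIcc_of_le hst, uIcc_of_le (hs.1.trans hs.2)]
    exact Icc_subset_Icc hs.1 ht.2
  have hdist := ENNReal.toReal_mono
    (ENNReal.mul_ne_top ENNReal.ofReal_ne_top (hfin' s t hs.1 ht.2))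
    (edist_sq_le_lintegral_metricSpeed_sq hac hst)
  rwa [ENNReal.toReal_mul, ENNReal.toReal_ofReal (sub_nonneg.2 hst), ENNReal.toReal_pow,
    edist_dist, ENNReal.toReal_ofReal dist_nonneg, ← hsub] at hdist

end AbsolutelyContinuous

/-! ### Kinetic action and lower semicontinuity -/

section KineticAction

variable {X : Type*} [MetricSpace X] {γ : Curve X} {w : ℝ → ℝ}

lemma curveExtend_of_mem (γ : Curve X) {t : ℝ} (ht : t ∈ Icc (0 : ℝ) 1) :
    curveExtend γ t = γ ⟨t, ht⟩ :=
  IccExtend_of_mem _ _ ht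

lemma exists_hasEnergyBound_of_kineticAction_ne_top (h : kineticAction γ ≠ ⊤) :
    ∃ w : ℝ → ℝ, HasEnergyBound (curveExtend γ) w (Icc 0 1) ∧ w 0 = 0 ∧
      w 1 = 2 * (kineticAction γ).toReal := by
  unfold kineticAction at h ⊢
  split_ifs at h ⊢ with hac
  · rw [← setLIntegral_congr Ioc_ae_eq_Icc] at h ⊢
    refine ⟨_, hasEnergyBound_lintegral_metricSpeed_sq hac fun htop => h ?_, by simp, by simp⟩
    rw [htop, ENNReal.mul_top (by simp)]
  · exact absurd rfl h

lemma HasEnergyBound.kineticAction_le (h : HasEnergyBound (curveExtend γ) w (Icc 0 1)) :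
    kineticAction γ ≤ 1 / 2 * ENNReal.ofReal (w 1 - w 0) := by
  rw [kineticAction, if_pos (h.absolutelyContinuousOnInterval zero_le_one)]
  gcongr
  refine lintegral_le_of_le_deriv zero_le_one h.monotoneOn (Eventually.of_forall fun t ht hw => ?_)
  have hsum := metricSpeed_sq_add_le (γ := curveExtend γ) (c := 0) le_rfl hw ?_
  · simpa only [ENNReal.ofReal_zero, add_zero] using hsum
  filter_upwards [nhdsWithin_le_nhds (Ioo_mem_nhds ht.1 ht.2)] with s hs
  have hs' := Ioo_subset_Icc_self hs
  have ht' := Ioo_subset_Icc_self ht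
  rcases le_total s t with hst | hst
  · linarith [h s hs' t ht' hst]
  · rw [dist_comm]
    linarith [h t ht' s hs' hst]

lemma kineticAction_le_of_edist_le_liminf {γs : ℕ → Curve X} {c : ℝ≥0∞} (hc : c ≠ ⊤)
    (hle : ∀ n, kineticAction (γs n) ≤ c)
    (hd : ∀ s t, edist (γ s) (γ t) ≤ liminf (fun n => edist (γs n s) (γs n t)) atTop) :
    kineticAction γ ≤ c := by
  choose w hw hw0 hw1 using fun n =>
    exists_hasEnergyBound_of_kineticAction_ne_top (ne_top_of_le_ne_top hc (hle n))
  have hbd : ∀ n, ∀ t ∈ Icc (0 : ℝ) 1, w n t ∈ Icc 0 (2 * c.toReal) := fun n t ht =>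
    ⟨(hw0 n).ge.trans ((hw n).monotoneOn ⟨le_rfl, zero_le_one⟩ ht ht.1),
      ((hw n).monotoneOn ht ⟨zero_le_one, le_rfl⟩ ht.2).trans <| (hw1 n).trans_le <| by
        gcongr; exact hle n⟩
  -- Compactness of `[0, 2c]` along an ultrafilter provides a pointwise limit of the `w n`.
  have hlim : ∀ t ∈ Icc (0 : ℝ) 1, ∃ l ∈ Icc 0 (2 * c.toReal),
      Tendsto (fun n => w n t) (hyperfilter ℕ) (𝓝 l) := fun t ht =>
    isCompact_Icc.ultrafilter_le_nhds ((hyperfilter ℕ).map fun n => w n t)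
      (le_principal_iff.2 (Ultrafilter.mem_map.2 (Eventually.of_forall fun n => hbd n t ht)))
  choose! W hWmem hW using hlim
  have hWbound : HasEnergyBound (curveExtend γ) W (Icc 0 1) := by
    refine .of_edist_le_liminf hw hW fun s hs t ht => ?_
    simp only [curveExtend_of_mem _ hs, curveExtend_of_mem _ ht]
    exact (hd _ _).trans (liminf_le_liminf_of_le Nat.hyperfilter_le_atTop)
  calc kineticAction γ ≤ 1 / 2 * ENNReal.ofReal (W 1 - W 0) := hWbound.kineticAction_le
    _ ≤ 1 / 2 * ENNReal.ofReal (2 * c.toReal) := by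
        gcongr
        linarith [(hWmem 0 ⟨le_rfl, zero_le_one⟩).1, (hWmem 1 ⟨zero_le_one, le_rfl⟩).2]
    _ = c := by
        rw [ENNReal.ofReal_mul two_pos.le, ENNReal.ofReal_toReal hc, ← mul_assoc]
        simp [ENNReal.inv_mul_cancel]

end KineticAction

section Liminf

variable {X : Type*} [MetricSpace X]

lemma action_le_liminf (E : X → EReal) (x y : X) (ε : ℕ → ℝ) {γs : ℕ → Curve X} {γ : Curve X}
    (hdist : ∀ s t, edist (γ s) (γ t) ≤ liminf (fun n => edist (γs n s) (γs n t)) atTop)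
    (hpoint : ∀ t z, edist (γ t) z ≤ liminf (fun n => edist (γs n t) z) atTop) :
    kineticAction γ + endpointIndicator x y γ ≤
      liminf (fun n => schrodingerAction E (ε n) (γs n) + endpointIndicator x y (γs n)) atTop := by
  refine le_of_forall_gt fun c hc => ?_
  obtain ⟨c', hc', hcc⟩ := exists_between hc
  obtain ⟨φ, hφ, hlt⟩ := extraction_of_frequently_atTop
    (frequently_lt_of_liminf_lt (by isBoundedDefault) hc')
  have hends : ∀ n, γs (φ n) 0 = x ∧ γs (φ n) 1 = y := by
    intro n
    by_contra h
    have := hlt n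
    rw [endpointIndicator, if_neg h, add_top] at this
    exact not_top_lt this
  have hsub : ∀ f : ℕ → ℝ≥0∞, liminf f atTop ≤ liminf (f ∘ φ) atTop := fun f =>
    (liminf_le_liminf_of_le hφ.tendsto_atTop).trans_eq (liminf_comp f φ atTop).symm
  have hend : ∀ t z, (∀ n, γs (φ n) t = z) → γ t = z := fun t z hz => by
    simpa [Function.comp_def, hz] using (hpoint t z).trans (hsub _)
  rw [endpointIndicator, if_pos ⟨hend 0 x fun n => (hends n).1, hend 1 y fun n => (hends n).2⟩,
    add_zero]
  exact (kineticAction_le_of_edist_le_liminf (γs := γs ∘ φ) hcc.ne_top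
    (fun n => (le_self_add.trans le_self_add).trans (hlt n).le)
    fun s t => (hdist s t).trans (hsub _)).trans_lt hcc

lemma action_le_liminf_of_tendsto_uniform (E : X → EReal) (x y : X) (ε : ℕ → ℝ)
    {γs : ℕ → Curve X} {γ : Curve X} (h : Tendsto γs atTop (@nhds _ (uniformTopology X) γ)) :
    kineticAction γ + endpointIndicator x y γ ≤
      liminf (fun n => schrodingerAction E (ε n) (γs n) + endpointIndicator x y (γs n)) atTop := by
  have hpt := (tendsto_uniformTopology_iff.1 h).tendsto_at
  exact action_le_liminf E x y ε (fun s t => ((hpt s).edist (hpt t)).liminf_eq.ge)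
    fun t z => ((hpt t).edist tendsto_const_nhds).liminf_eq.ge

lemma action_le_liminf_of_tendsto_pointwise (σ : TopologicalSpace X) (E : X → EReal) (x y : X)
    (hlsc : ∀ (u v : ℕ → X) (a b : X), Tendsto u atTop (@nhds X σ a) →
      Tendsto v atTop (@nhds X σ b) → edist a b ≤ liminf (fun n => edist (u n) (v n)) atTop)
    (ε : ℕ → ℝ) {γs : ℕ → Curve X} {γ : Curve X}
    (h : Tendsto γs atTop (@nhds _ (pointwiseTopology σ) γ)) :
    kineticAction γ + endpointIndicator x y γ ≤
      liminf (fun n => schrodingerAction E (ε n) (γs n) + endpointIndicator x y (γs n)) atTop := by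
  have hpt := (tendsto_pointwiseTopology_iff σ).1 h
  exact action_le_liminf E x y ε (fun s t => hlsc _ _ _ _ (hpt s) (hpt t))
    fun t z => hlsc _ (fun _ => z) _ z (hpt t) (@tendsto_const_nhds X σ ℕ z atTop)

lemma tendsto_of_tendsto_metric {ι : Type*} {l : Filter ι} [l.IsCountablyGenerated] {u : ι → X}
    {z : X} (h : Tendsto u l (𝓝 z)) {σ : TopologicalSpace X}
    (hcompact : ∀ u : ℕ → X, Bornology.IsBounded (range u) →
      ∃ (z : X) (φ : ℕ → ℕ), StrictMono φ ∧ Tendsto (u ∘ φ) atTop (@nhds X σ z))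
    (hlsc : ∀ (u v : ℕ → X) (a b : X), Tendsto u atTop (@nhds X σ a) →
      Tendsto v atTop (@nhds X σ b) → edist a b ≤ liminf (fun n => edist (u n) (v n)) atTop) :
    Tendsto u l (@nhds X σ z) := by
  refine tendsto_of_seq_tendsto fun ψ hψ => tendsto_of_subseq_tendsto fun θ hθ => ?_
  have hu := (h.comp hψ).comp hθ
  obtain ⟨z', φ, hφ, hlim⟩ := hcompact _ (Metric.isBounded_range_of_tendsto _ hu)
  have hedist := (tendsto_iff_edist_tendsto_0.1 hu).comp hφ.tendsto_atTop
  obtain rfl : z' = z := edist_le_zero.1 <|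
    (hlsc _ (fun _ => z) z' z hlim (@tendsto_const_nhds X σ ℕ z atTop)).trans hedist.liminf_eq.le
  exact ⟨φ, hlim⟩

lemma tendsto_pointwiseTopology {ι : Type*} {l : Filter ι} [l.IsCountablyGenerated]
    {γs : ι → Curve X} {γ : Curve X} (h : Tendsto γs l (𝓝 γ)) {σ : TopologicalSpace X}
    (hcompact : ∀ u : ℕ → X, Bornology.IsBounded (range u) →
      ∃ (z : X) (φ : ℕ → ℕ), StrictMono φ ∧ Tendsto (u ∘ φ) atTop (@nhds X σ z))
    (hlsc : ∀ (u v : ℕ → X) (a b : X), Tendsto u atTop (@nhds X σ a) →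
      Tendsto v atTop (@nhds X σ b) → edist a b ≤ liminf (fun n => edist (u n) (v n)) atTop) :
    Tendsto γs l (@nhds _ (pointwiseTopology σ) γ) :=
  (tendsto_pointwiseTopology_iff σ).2 fun t => tendsto_of_tendsto_metric
    ((tendsto_uniformTopology_iff.1 h).tendsto_at t) hcompact hlsc

end Liminf

/-! ### Gradient flows in integrated form -/

section ExpIntegral

/-- `∫₀^δ exp (κ r) dr`, that is `(exp (κ δ) - 1) / κ`, with the value `δ` for `κ = 0`. It is the
weight of the energy in the integrated evolution variational inequality with parameter `-κ`. -/
def expIntegral (κ δ : ℝ) : ℝ := ∫ r in (0 : ℝ)..δ, Real.exp (κ * r)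

lemma continuous_expIntegral (κ : ℝ) : Continuous (expIntegral κ) :=
  intervalIntegral.continuous_primitive
    (fun a b => Continuous.intervalIntegrable (by fun_prop) a b) 0

lemma mul_expIntegral (κ δ : ℝ) : κ * expIntegral κ δ = Real.exp (κ * δ) - 1 := by
  rw [expIntegral, intervalIntegral.mul_integral_comp_mul_left (f := Real.exp), integral_exp,
    mul_zero, Real.exp_zero]

variable {κ δ : ℝ}

lemma le_expIntegral (hκ : 0 ≤ κ) (hδ : 0 ≤ δ) : δ ≤ expIntegral κ δ := by
  calc δ = ∫ _ in (0 : ℝ)..δ, (1 : ℝ) := by simp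
    _ ≤ expIntegral κ δ :=
      intervalIntegral.integral_mono_on hδ intervalIntegrable_const
        (Continuous.intervalIntegrable (by fun_prop) _ _)
        fun r hr => Real.one_le_exp (mul_nonneg hκ hr.1)

lemma expIntegral_le (hκ : 0 ≤ κ) (hδ : 0 ≤ δ) : expIntegral κ δ ≤ δ * Real.exp (κ * δ) := by
  calc expIntegral κ δ ≤ ∫ _ in (0 : ℝ)..δ, Real.exp (κ * δ) :=
      intervalIntegral.integral_mono_on hδ (Continuous.intervalIntegrable (by fun_prop) _ _)
        intervalIntegrable_const
        fun r hr => Real.exp_le_exp.2 (mul_le_mul_of_nonneg_left hr.2 hκ)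
    _ = δ * Real.exp (κ * δ) := by simp

lemma expIntegral_nonneg (κ : ℝ) (hδ : 0 ≤ δ) : 0 ≤ expIntegral κ δ :=
  intervalIntegral.integral_nonneg hδ fun _ _ => (Real.exp_pos _).le

lemma expIntegral_add_self (κ δ : ℝ) :
    expIntegral κ (δ + δ) = (Real.exp (κ * δ) + 1) * expIntegral κ δ := by
  have hint : ∀ a b, IntervalIntegrable (fun r => Real.exp (κ * r)) volume a b := fun a b =>
    Continuous.intervalIntegrable (by fun_prop) a b
  have hshift : ∫ r in δ..δ + δ, Real.exp (κ * r) = Real.exp (κ * δ) * expIntegral κ δ := by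
    rw [expIntegral, ← intervalIntegral.integral_const_mul]
    simp only [← Real.exp_add, ← mul_add]
    rw [intervalIntegral.integral_comp_add_left (fun r => Real.exp (κ * r)), add_zero]
  rw [expIntegral, ← intervalIntegral.integral_add_adjacent_intervals (hint 0 δ) (hint _ _), hshift,
    expIntegral]
  ring

lemma integral_exp_mul_sub (κ s t : ℝ) :
    ∫ r in s..t, Real.exp (κ * (t - r)) = expIntegral κ (t - s) := by
  rw [intervalIntegral.integral_comp_sub_left (fun r => Real.exp (κ * r)), sub_self, expIntegral]

end ExpIntegral

namespace IsEVIFlowFrom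

variable {X : Type*} [MetricSpace X] {E : X → EReal} {lam : ℝ} {u : ℝ → X} {x y : X} {s t : ℝ}

lemma mono {lam' : ℝ} (hu : IsEVIFlowFrom E lam u x) (h : lam' ≤ lam) :
    IsEVIFlowFrom E lam' u x where
  locallyAC := hu.locallyAC
  start := hu.start
  evi y := by
    filter_upwards [hu.evi y] with t ht
    refine le_trans ?_ ht
    gcongr

lemma ae_evi_toReal (hu : IsEVIFlowFrom E lam u x) (hbot : ∀ z, E z ≠ ⊥) (hy : E y ≠ ⊤) :
    ∀ᵐ t, 0 < t → E (u t) ≠ ⊤ ∧ 1 / 2 * deriv (fun s => dist (u s) y ^ 2) t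
      + lam / 2 * dist (u t) y ^ 2 + (E (u t)).toReal ≤ (E y).toReal := by
  have h := hu.evi y
  rw [ae_restrict_iff' measurableSet_Ioi] at h
  filter_upwards [h] with t ht ht₀
  have hle := ht ht₀
  have hfin : E (u t) ≠ ⊤ := by
    intro htop
    rw [htop, EReal.coe_add_top, top_le_iff] at hle
    exact hy hle
  refine ⟨hfin, ?_⟩
  rw [← EReal.coe_toReal hfin (hbot _), ← EReal.coe_toReal hy (hbot _)] at hle
  exact_mod_cast hle

lemma continuousOn_Ioi (hu : IsEVIFlowFrom E lam u x) : ContinuousOn u (Ioi 0) := by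
  intro t (ht : 0 < t)
  have hlt : t / 2 < t := half_lt_self ht
  have hcont := (absolutelyContinuousOnInterval_dist
    (hu.locallyAC (t / 2) (t + 1) (half_pos ht) (by linarith)) (u t)).continuousOn
  rw [uIcc_of_le (by linarith)] at hcont
  have hlim := hcont.continuousAt (Icc_mem_nhds hlt (lt_add_one t))
  rw [ContinuousAt, dist_self] at hlim
  exact (tendsto_iff_dist_tendsto_zero.2 hlim).mono_left nhdsWithin_le_nhds

lemma continuousOn_Icc (hu : IsEVIFlowFrom E lam u x) (hs : 0 < s) : ContinuousOn u (Icc s t) :=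
  hu.continuousOn_Ioi.mono fun _ hr => hs.trans_le hr.1

lemma lowerSemicontinuousOn_energy (hu : IsEVIFlowFrom E lam u x) (hlsc : LowerSemicontinuous E)
    (hs : 0 < s) : LowerSemicontinuousOn (fun r => E (u r)) (Icc s t) :=
  (hlsc.lowerSemicontinuousOn univ).comp (hu.continuousOn_Icc hs) (mapsTo_univ _ _)

lemma aestronglyMeasurable_energy (hu : IsEVIFlowFrom E lam u x) (hlsc : LowerSemicontinuous E)
    (hs : 0 < s) (hst : s ≤ t) :
    AEStronglyMeasurable (fun r => (E (u r)).toReal) (volume.restrict (Ioc s t)) := by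
  have hmeas : Measurable fun r => E (IccExtend hst ((Icc s t).domRestrict u) r) :=
    (hlsc.comp (continuousOn_iff_continuous_domRestrict.1
      (hu.continuousOn_Icc hs)).Icc_extend').measurable
  refine hmeas.ereal_toReal.aestronglyMeasurable.congr ?_
  filter_upwards [ae_restrict_mem measurableSet_Ioc] with r hr
  rw [IccExtend_of_mem hst _ (Ioc_subset_Icc_self hr), domRestrict_apply]

lemma intervalIntegrable_energy (hu : IsEVIFlowFrom E lam u x) (hlsc : LowerSemicontinuous E)
    (hbot : ∀ z, E z ≠ ⊥) (hy : E y ≠ ⊤) (hs : 0 < s) (hst : s ≤ t) :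
    IntervalIntegrable (fun r => (E (u r)).toReal) volume s t := by
  obtain ⟨p, -, hp⟩ := (hu.lowerSemicontinuousOn_energy hlsc hs).exists_isMinOn
    (nonempty_Icc.2 hst) isCompact_Icc
  have hac := absolutelyContinuousOnInterval_dist_sq (hu.locallyAC s t hs hst) y
  have hupper : IntervalIntegrable (fun r => (E y).toReal - (1 / 2 *
      deriv (fun r => dist (u r) y ^ 2) r + lam / 2 * dist (u r) y ^ 2)) volume s t :=
    intervalIntegrable_const.sub ((hac.intervalIntegrable_deriv.const_mul _).add
      (hac.continuousOn.intervalIntegrable.const_mul _))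
  rw [intervalIntegrable_iff_integrableOn_Ioc_of_le hst] at hupper ⊢
  refine integrable_of_le_of_le (hu.aestronglyMeasurable_energy hlsc hs hst)
    (g₁ := fun _ => (E (u p)).toReal) ?_ ?_ (integrable_const _) hupper
  all_goals
    filter_upwards [ae_restrict_mem measurableSet_Ioc,
      ae_restrict_of_ae (hu.ae_evi_toReal hbot hy)] with r hr hevi
    obtain ⟨hfin, hle⟩ := hevi (hs.trans hr.1)
  · exact EReal.toReal_le_toReal (hp (Ioc_subset_Icc_self hr)) (hbot _) hfin
  · linarith

/-- Multiply the inequality by `exp (lam r)` and integrate. -/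
lemma integral_evi (hu : IsEVIFlowFrom E lam u x) (hlsc : LowerSemicontinuous E)
    (hbot : ∀ z, E z ≠ ⊥) (hy : E y ≠ ⊤) (hs : 0 < s) (hst : s ≤ t) :
    Real.exp (lam * t) / 2 * dist (u t) y ^ 2 - Real.exp (lam * s) / 2 * dist (u s) y ^ 2 ≤
      ∫ r in s..t, Real.exp (lam * r) * ((E y).toReal - (E (u r)).toReal) := by
  have hac := absolutelyContinuousOnInterval_dist_sq (hu.locallyAC s t hs hst) y
  have hder : deriv (fun r => Real.exp (lam * r) / 2) = fun r => lam * Real.exp (lam * r) / 2 := by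
    ext r
    exact ((((hasDerivAt_id r).const_mul lam).exp).div_const 2).deriv.trans (by simp; ring)
  have hexp : AbsolutelyContinuousOnInterval (fun r => Real.exp (lam * r) / 2) s t :=
    ContDiffOn.absolutelyContinuousOnInterval (by fun_prop)
  have hleft : IntervalIntegrable (fun r => deriv (fun r => dist (u r) y ^ 2) r *
      (Real.exp (lam * r) / 2) + dist (u r) y ^ 2 * deriv (fun r => Real.exp (lam * r) / 2) r)
      volume s t := by
    refine (hac.intervalIntegrable_deriv.mul_continuousOn (by fun_prop)).add
      (ContinuousOn.intervalIntegrable (hac.continuousOn.mul ?_))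
    rw [hder]
    fun_prop
  have hright : IntervalIntegrable (fun r => Real.exp (lam * r) * ((E y).toReal - (E (u r)).toReal))
      volume s t :=
    (intervalIntegrable_const.sub
      (hu.intervalIntegrable_energy hlsc hbot hy hs hst)).continuousOn_mul (by fun_prop)
  calc _ = dist (u t) y ^ 2 * (Real.exp (lam * t) / 2)
        - dist (u s) y ^ 2 * (Real.exp (lam * s) / 2) := by ring
    _ = _ := (hac.integral_deriv_mul_eq_sub hexp).symm
    _ ≤ _ := by
      refine intervalIntegral.integral_mono_ae_restrict hst hleft hright ?_
      filter_upwards [ae_restrict_mem measurableSet_Icc,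
        ae_restrict_of_ae (hu.ae_evi_toReal hbot hy)] with r hr hevi
      rw [hder]
      linarith [mul_le_mul_of_nonneg_left (hevi (hs.trans_le hr.1)).2 (Real.exp_pos (lam * r)).le]

/-- Consider the last time `q ∈ [s, t]` with `E (u q) ≤ E (u s)`. If `q < t`, then
`E (u q) < E (u r)` for `q < r ≤ t`, against the inequality with observer `u q` on `[q, t]`. -/
lemma energy_le (hu : IsEVIFlowFrom E lam u x) (hlsc : LowerSemicontinuous E)
    (hbot : ∀ z, E z ≠ ⊥) (hy : E y ≠ ⊤) (hs : 0 < s) (hst : s ≤ t) : E (u t) ≤ E (u s) := by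
  obtain ⟨v, hv, hsub⟩ := lowerSemicontinuousOn_iff_preimage_Iic.1
    (hu.lowerSemicontinuousOn_energy (t := t) hlsc hs) (E (u s))
  obtain ⟨q, hq, hqmax⟩ := (hsub ▸ isCompact_Icc.inter_right hv :
    IsCompact (Icc s t ∩ (fun r => E (u r)) ⁻¹' Iic (E (u s)))).exists_isGreatest
      ⟨s, ⟨le_rfl, hst⟩, le_refl (E (u s))⟩
  obtain ⟨⟨hsq, hqt⟩, hqs : E (u q) ≤ E (u s)⟩ := hq
  rcases hqt.eq_or_lt with rfl | hqt
  · exact hqs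
  have hafter : ∀ r ∈ Ioc q t, E (u q) < E (u r) := fun r hr => by
    by_contra! h
    exact (hqmax ⟨⟨hsq.trans hr.1.le, hr.2⟩, h.trans hqs⟩).not_gt hr.1
  have hqtop : E (u q) ≠ ⊤ := (hafter t ⟨hqt, le_rfl⟩).ne_top
  have hq₀ : 0 < q := hs.trans_le hsq
  have hneg : ∫ r in q..t, Real.exp (lam * r) * ((E (u q)).toReal - (E (u r)).toReal) <
      ∫ _ in q..t, (0 : ℝ) := by
    have hlt : ∀ᵐ r ∂volume.restrict (Ioc q t),
        Real.exp (lam * r) * ((E (u q)).toReal - (E (u r)).toReal) < 0 := by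
      filter_upwards [ae_restrict_mem measurableSet_Ioc,
        ae_restrict_of_ae (hu.ae_evi_toReal hbot hy)] with r hr hevi
      refine mul_neg_of_pos_of_neg (Real.exp_pos _) (sub_neg.2 ?_)
      rw [← EReal.coe_lt_coe_iff, EReal.coe_toReal hqtop (hbot _),
        EReal.coe_toReal (hevi (hq₀.trans hr.1)).1 (hbot _)]
      exact hafter r hr
    have : (ae (volume.restrict (Ioc q t))).NeBot := by
      rw [ae_neBot, Ne, Measure.restrict_eq_zero]
      simp [hqt]
    refine intervalIntegral.integral_lt_integral_of_ae_le_of_measure_setOfPred_lt_ne_zero hqt.le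
      ((intervalIntegrable_const.sub (hu.intervalIntegrable_energy hlsc hbot hy hq₀
        hqt.le)).continuousOn_mul (by fun_prop)) intervalIntegrable_const (hlt.mono fun _ h => h.le)
      (frequently_ae_iff.1 hlt.frequently)
  have hevi := hu.integral_evi hlsc hbot hqtop hq₀ hqt.le
  rw [dist_self] at hevi
  simp only [intervalIntegral.integral_zero] at hneg
  nlinarith [mul_nonneg (Real.exp_pos (lam * t)).le (sq_nonneg (dist (u t) (u q)))]

lemma energy_ne_top (hu : IsEVIFlowFrom E lam u x) (hlsc : LowerSemicontinuous E)
    (hbot : ∀ z, E z ≠ ⊥) (hy : E y ≠ ⊤) (ht : 0 < t) : E (u t) ≠ ⊤ := by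
  have : (ae (volume.restrict (Ioo 0 t))).NeBot := by
    rw [ae_neBot, Ne, Measure.restrict_eq_zero]
    simp [ht]
  have hae : ∀ᵐ r ∂volume.restrict (Ioo 0 t), r ∈ Ioo 0 t ∧ E (u r) ≠ ⊤ := by
    filter_upwards [ae_restrict_mem measurableSet_Ioo,
      ae_restrict_of_ae (hu.ae_evi_toReal hbot hy)] with r hr hevi
    exact ⟨hr, (hevi hr.1).1⟩
  obtain ⟨r, hr, hfin⟩ := hae.exists
  exact ne_top_of_le_ne_top hfin (hu.energy_le hlsc hbot hy hr.1 hr.2.le)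

lemma dist_sq_le (hu : IsEVIFlowFrom E lam u x) (hlsc : LowerSemicontinuous E)
    (hbot : ∀ z, E z ≠ ⊥) (hy : E y ≠ ⊤) (hs : 0 < s) (hst : s ≤ t) :
    dist (u t) y ^ 2 ≤ Real.exp (-lam * (t - s)) * dist (u s) y ^ 2 +
      2 * expIntegral (-lam) (t - s) * ((E y).toReal - (E (u t)).toReal) := by
  have hmono : ∫ r in s..t, Real.exp (lam * r) * ((E y).toReal - (E (u r)).toReal) ≤
      ∫ r in s..t, Real.exp (lam * r) * ((E y).toReal - (E (u t)).toReal) := by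
    refine intervalIntegral.integral_mono_on hst ((intervalIntegrable_const.sub
      (hu.intervalIntegrable_energy hlsc hbot hy hs hst)).continuousOn_mul (by fun_prop))
      (Continuous.intervalIntegrable (by fun_prop) _ _) fun r hr => ?_
    have hr₀ : 0 < r := hs.trans_le hr.1
    gcongr
    exact EReal.toReal_le_toReal (hu.energy_le hlsc hbot hy hr₀ hr.2) (hbot _)
      (hu.energy_ne_top hlsc hbot hy hr₀)
  have hexp : ∀ r, Real.exp (-lam * (t - r)) = Real.exp (-lam * t) * Real.exp (lam * r) := by
    intro r
    rw [← Real.exp_add]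
    ring_nf
  have hcancel : Real.exp (-lam * t) * Real.exp (lam * t) = 1 := by
    rw [← hexp, sub_self, mul_zero, Real.exp_zero]
  have hevi := (hu.integral_evi hlsc hbot hy hs hst).trans hmono
  rw [intervalIntegral.integral_mul_const] at hevi
  rw [← integral_exp_mul_sub]
  simp only [hexp, intervalIntegral.integral_const_mul]
  linear_combination (2 * Real.exp (-lam * t)) * hevi - dist (u t) y ^ 2 * hcancel

end IsEVIFlowFrom

section Partition

lemma le_of_forall_step_le {f : ℝ → ℝ} {a b : ℝ} (hab : a ≤ b) {n : ℕ} (hn : n ≠ 0)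
    (h : ∀ s, a ≤ s → s + (b - a) / n ≤ b → f (s + (b - a) / n) ≤ f s) : f b ≤ f a := by
  set η := (b - a) / n
  have hη : 0 ≤ η := div_nonneg (sub_nonneg.2 hab) n.cast_nonneg
  have hnη : n * η = b - a := mul_div_cancel₀ _ (Nat.cast_ne_zero.2 hn)
  have hstep : ∀ k ≤ n, f (a + k * η) ≤ f a := by
    intro k
    induction k with
    | zero => simp
    | succ k ih =>
      intro hk
      have hk' : ((k + 1 : ℕ) : ℝ) * η ≤ n * η := by gcongr
      push_cast at hk' ⊢
      have hle := h (a + k * η) (le_add_of_nonneg_right (mul_nonneg k.cast_nonneg hη)) (by linarith)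
      rw [add_assoc, ← add_one_mul] at hle
      exact hle.trans (ih (by lia))
  simpa [hnη] using hstep n le_rfl

lemma le_of_sub_le_mul_sub {Q M : ℝ → ℝ} {a b : ℝ} (hab : a ≤ b)
    (h : ∀ s t, a ≤ s → s ≤ t → t ≤ b → Q t - Q s ≤ (t - s) * (M t - M s)) : Q b ≤ Q a := by
  have hn : ∀ᶠ n : ℕ in atTop, Q b - Q a ≤ (b - a) / n * (M b - M a) := by
    filter_upwards [eventually_ne_atTop 0] with n hn
    have := le_of_forall_step_le (f := fun t => Q t - (b - a) / n * M t) hab hn fun s hs hsb => by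
      have hη : 0 ≤ (b - a) / n := div_nonneg (sub_nonneg.2 hab) n.cast_nonneg
      have := h s _ hs (le_add_of_nonneg_right hη) hsb
      rw [add_sub_cancel_left] at this
      linarith
    linarith
  have hlim := (tendsto_const_div_atTop_nhds_zero_nat (b - a)).mul_const (M b - M a)
  rw [zero_mul] at hlim
  exact sub_nonpos.1 (ge_of_tendsto hlim hn)

end Partition

/-- The integrated form, with the energy frozen at its final and smallest value, of the evolution
variational inequality with parameter `-κ`. Unlike in `IsEVIFlowFrom`, the curve starts at `u 0`. -/
structure IsIntegralEVI {X : Type*} [MetricSpace X] (E : X → EReal) (κ : ℝ) (u : ℝ → X) :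
    Prop where
  continuousOn : ContinuousOn u (Ici 0)
  ne_top : ∀ t, 0 < t → E (u t) ≠ ⊤
  dist_sq_le : ∀ (y : X) (s t : ℝ), E y ≠ ⊤ → 0 ≤ s → s ≤ t → dist (u t) y ^ 2 ≤
    Real.exp (κ * (t - s)) * dist (u s) y ^ 2 +
      2 * expIntegral κ (t - s) * ((E y).toReal - (E (u t)).toReal)

section FlowEstimates

variable {X : Type*} [MetricSpace X] {E : X → EReal} {κ lam : ℝ} {u v : ℝ → X} {x y : X}
  {s t T : ℝ}

lemma IsEVIFlowFrom.exists_isIntegralEVI (hu : IsEVIFlowFrom E lam u x)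
    (hlsc : LowerSemicontinuous E) (hbot : ∀ z, E z ≠ ⊥) (hy : E y ≠ ⊤) :
    ∃ v, v 0 = x ∧ IsIntegralEVI E (-lam) v := by
  set v := Function.update u 0 x with hv
  have hv₀ : v 0 = x := Function.update_self ..
  have hvpos : ∀ {t}, 0 < t → v t = u t := fun ht => Function.update_of_ne ht.ne' ..
  have hcont : ContinuousOn v (Ici 0) := by
    rw [hv, continuousOn_update_iff, Ici_sdiff_left]
    exact ⟨hu.continuousOn_Ioi, fun _ => hu.start⟩
  refine ⟨v, hv₀, hcont, fun t ht => ?_, fun y s t hy hs hst => ?_⟩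
  · rw [hvpos ht]
    exact hu.energy_ne_top hlsc hbot hy ht
  have hpos : ∀ s, 0 < s → s ≤ t → dist (v t) y ^ 2 ≤
      Real.exp (-lam * (t - s)) * dist (v s) y ^ 2 +
        2 * expIntegral (-lam) (t - s) * ((E y).toReal - (E (v t)).toReal) := fun s hs hst => by
    rw [hvpos (hs.trans_le hst), hvpos hs]
    exact hu.dist_sq_le hlsc hbot hy hs hst
  rcases hs.eq_or_lt with rfl | hs
  · rcases hst.eq_or_lt with rfl | ht
    · simp [expIntegral]
    have hlim : ContinuousWithinAt (fun s => Real.exp (-lam * (t - s)) * dist (v s) y ^ 2 +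
        2 * expIntegral (-lam) (t - s) * ((E y).toReal - (E (v t)).toReal)) (Ici 0) 0 := by
      have := hcont 0 self_mem_Ici
      have hJ := continuous_expIntegral (-lam)
      fun_prop
    refine ge_of_tendsto (hlim.mono_left (nhdsWithin_mono _ Ioi_subset_Ici_self)) ?_
    filter_upwards [Ioc_mem_nhdsGT ht] with s hs
    exact hpos s hs.1 hs.2
  · exact hpos s hs hst

namespace IsIntegralEVI

lemma shift (hu : IsIntegralEVI E κ u) {h : ℝ} (hh : 0 ≤ h) :
    IsIntegralEVI E κ fun t => u (h + t) where
  continuousOn := hu.continuousOn.comp (by fun_prop) fun _ ht => add_nonneg hh ht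
  ne_top t ht := hu.ne_top _ (by linarith)
  dist_sq_le y s t hy hs hst := by
    simpa using hu.dist_sq_le y (h + s) (h + t) hy (add_nonneg hh hs) (by linarith)

lemma energy_sub_nonneg (hu : IsIntegralEVI E κ u) (hs : 0 < s) (hst : s ≤ t) :
    0 ≤ (E (u s)).toReal - (E (u t)).toReal := by
  rcases hst.eq_or_lt with rfl | hlt
  · simp
  have h := hu.dist_sq_le (u s) s t (hu.ne_top s hs) hs.le hst
  have hJ : 0 < expIntegral κ (t - s) :=
    intervalIntegral.intervalIntegral_pos_of_pos
      (Continuous.intervalIntegrable (by fun_prop) _ _) (fun _ => Real.exp_pos _) (sub_pos.2 hlt)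
  rw [dist_self] at h
  have : 0 ≤ 2 * expIntegral κ (t - s) * ((E (u s)).toReal - (E (u t)).toReal) := by
    nlinarith [sq_nonneg (dist (u t) (u s))]
  exact nonneg_of_mul_nonneg_right this (by positivity)

/-- Use `v t` as an observer of `u` on `[s, t]`, and `u s` as an observer of `v`. -/
lemma dist_sq_sub_le (hu : IsIntegralEVI E κ u) (hv : IsIntegralEVI E κ v) (hs : 0 < s)
    (hst : s ≤ t) :
    dist (u t) (v t) ^ 2 - Real.exp (κ * (t - s)) ^ 2 * dist (u s) (v s) ^ 2 ≤
      2 * expIntegral κ (t - s) * ((E (u s)).toReal - (E (u t)).toReal +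
        κ * expIntegral κ (t - s) * ((E (u s)).toReal - (E (v t)).toReal)) := by
  have h₁ := hu.dist_sq_le (v t) s t (hv.ne_top t (hs.trans_le hst)) hs.le hst
  have h₂ := hv.dist_sq_le (u s) s t (hu.ne_top s hs) hs.le hst
  rw [dist_comm, dist_comm (v s)] at h₂
  rw [mul_expIntegral]
  linear_combination h₁ + Real.exp (κ * (t - s)) * h₂

lemma dist_sq_sub_le_mul (hu : IsIntegralEVI E κ u) (hv : IsIntegralEVI E κ v) (hκ : 0 ≤ κ)
    (hs : 0 < s) (hst : s ≤ t) (hT : t - s ≤ T) {B : ℝ} (hB₀ : 0 ≤ B)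
    (hB : (E (u s)).toReal - (E (v t)).toReal ≤ B) :
    dist (u t) (v t) ^ 2 - Real.exp (κ * (t - s)) ^ 2 * dist (u s) (v s) ^ 2 ≤
      (t - s) * (2 * Real.exp (κ * T) *
        ((E (u s)).toReal - (E (u t)).toReal + κ * Real.exp (κ * T) * B * (t - s))) := by
  have hδ : 0 ≤ t - s := sub_nonneg.2 hst
  have hJ₀ : 0 ≤ expIntegral κ (t - s) := expIntegral_nonneg κ hδ
  have hJ : expIntegral κ (t - s) ≤ (t - s) * Real.exp (κ * T) :=
    (expIntegral_le hκ hδ).trans (by gcongr)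
  have hE := hu.energy_sub_nonneg hs hst
  calc _ ≤ 2 * expIntegral κ (t - s) * ((E (u s)).toReal - (E (u t)).toReal +
        κ * expIntegral κ (t - s) * B) := by
        refine (hu.dist_sq_sub_le hv hs hst).trans ?_
        gcongr
    _ ≤ 2 * ((t - s) * Real.exp (κ * T)) * ((E (u s)).toReal - (E (u t)).toReal +
        κ * ((t - s) * Real.exp (κ * T)) * B) := by gcongr
    _ = _ := by ring

lemma dist_le_of_pos (hu : IsIntegralEVI E κ u) (hv : IsIntegralEVI E κ v) (hκ : 0 ≤ κ)
    (hs : 0 < s) (hst : s ≤ t) :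
    dist (u t) (v t) ≤ Real.exp (κ * (t - s)) * dist (u s) (v s) := by
  set B := |(E (u s)).toReal - (E (v t)).toReal|
  set C := Real.exp (κ * (t - s))
  have hsq : Real.exp (κ * (s - t)) ^ 2 * dist (u t) (v t) ^ 2 ≤
      Real.exp (κ * (s - s)) ^ 2 * dist (u s) (v s) ^ 2 := by
    refine le_of_sub_le_mul_sub (Q := fun r => Real.exp (κ * (s - r)) ^ 2 * dist (u r) (v r) ^ 2)
      (M := fun r => 2 * C * (κ * C * B * r - (E (u r)).toReal)) hst fun p r hp hpr hr => ?_
    have hp₀ : 0 < p := hs.trans_le hp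
    have hδ : 0 ≤ r - p := sub_nonneg.2 hpr
    have hB : (E (u p)).toReal - (E (v r)).toReal ≤ B := by
      have hu := hu.energy_sub_nonneg hs hp
      have hv := hv.energy_sub_nonneg (hp₀.trans_le hpr) hr
      exact le_trans (by linarith) (le_abs_self _)
    have hE := hu.energy_sub_nonneg hp₀ hpr
    have hexp : Real.exp (κ * (s - p)) ^ 2 =
        Real.exp (κ * (s - r)) ^ 2 * Real.exp (κ * (r - p)) ^ 2 := by
      rw [← mul_pow, ← Real.exp_add]
      ring_nf
    calc _ = Real.exp (κ * (s - r)) ^ 2 *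
          (dist (u r) (v r) ^ 2 - Real.exp (κ * (r - p)) ^ 2 * dist (u p) (v p) ^ 2) := by
          rw [hexp]
          ring
      _ ≤ Real.exp (κ * (s - r)) ^ 2 * ((r - p) * (2 * C *
          ((E (u p)).toReal - (E (u r)).toReal + κ * C * B * (r - p)))) := by
          gcongr
          exact hu.dist_sq_sub_le_mul hv hκ hp₀ hpr (by linarith) (abs_nonneg _) hB
      _ ≤ (r - p) * (2 * C * ((E (u p)).toReal - (E (u r)).toReal + κ * C * B * (r - p))) := by
          refine mul_le_of_le_one_left (mul_nonneg hδ (mul_nonneg (by positivity)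
            (add_nonneg hE (mul_nonneg (by positivity) hδ)))) ?_
          refine pow_le_one₀ (Real.exp_pos _).le (Real.exp_le_one_iff.2 ?_)
          exact mul_nonpos_of_nonneg_of_nonpos hκ (sub_nonpos.2 (hp.trans hpr))
      _ = _ := by ring
  rw [sub_self, mul_zero, Real.exp_zero, one_pow, one_mul, ← mul_pow,
    pow_le_pow_iff_left₀ (by positivity) dist_nonneg two_ne_zero, ← neg_sub, mul_neg,
    Real.exp_neg, inv_mul_le_iff₀ (Real.exp_pos _)] at hsq
  exact hsq

lemma dist_le (hu : IsIntegralEVI E κ u) (hv : IsIntegralEVI E κ v) (hκ : 0 ≤ κ)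
    (hs : 0 ≤ s) (hst : s ≤ t) :
    dist (u t) (v t) ≤ Real.exp (κ * (t - s)) * dist (u s) (v s) := by
  rcases hs.eq_or_lt with rfl | hs
  · rcases hst.eq_or_lt with rfl | ht
    · simp
    have hexp : Continuous fun s => Real.exp (κ * (t - s)) := by fun_prop
    have hlim : ContinuousWithinAt (fun s => Real.exp (κ * (t - s)) * dist (u s) (v s))
        (Ici 0) 0 :=
      hexp.continuousWithinAt.mul ((hu.continuousOn 0 self_mem_Ici).dist
        (hv.continuousOn 0 self_mem_Ici))
    refine ge_of_tendsto (hlim.mono_left (nhdsWithin_mono _ Ioi_subset_Ici_self)) ?_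
    filter_upwards [Ioc_mem_nhdsGT ht] with s hs
    exact hu.dist_le_of_pos hv hκ hs.1 hs.2
  · exact hu.dist_le_of_pos hv hκ hs hst

end IsIntegralEVI
end FlowEstimates

/-! ### Descending slope and energy dissipation -/

/-- The `κ`-corrected global descending slope `sup_y (E z - E y - κ/2 d²(z, y)) / d(z, y)` is
larger than `q`, or `q = 0`. In contrast to `q < metricSlope E z` this is an open condition on `z`.
The real number `c` stands for `E z`, which may be infinite. -/
def HasDescent {X : Type*} [MetricSpace X] (E : X → EReal) (κ : ℝ) (z : X) (q : NNReal) : Prop :=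
  q = 0 ∨ ∃ (y : X) (c : ℝ), E y ≠ ⊤ ∧ 0 < dist z y ∧ (c : EReal) < E z ∧
    q * dist z y < c - (E y).toReal - κ / 2 * dist z y ^ 2

section Dissipation

variable {X : Type*} [MetricSpace X] {E : X → EReal} {κ : ℝ} {u : ℝ → X} {y z : X}
  {q : NNReal} {r s η T : ℝ}

lemma HasDescent.eventually (h : HasDescent E κ z q) (hlsc : LowerSemicontinuous E) :
    ∀ᶠ z' in 𝓝 z, HasDescent E κ z' q := by
  rcases h with hq | ⟨y, c, hy, hd, hc, hlt⟩
  · exact Eventually.of_forall fun _ => Or.inl hq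
  have hd' : ∀ᶠ z' in 𝓝 z, 0 < dist z' y :=
    (by fun_prop : Continuous fun z' => dist z' y).continuousAt.eventually_const_lt hd
  have hlt' : ∀ᶠ z' in 𝓝 z, q * dist z' y < c - (E y).toReal - κ / 2 * dist z' y ^ 2 :=
    ContinuousAt.eventually_lt (f := fun z' => q * dist z' y)
      (g := fun z' => c - (E y).toReal - κ / 2 * dist z' y ^ 2) (by fun_prop) (by fun_prop) hlt
  filter_upwards [hd', hlt', hlsc z c hc] with z' hd hlt hc
  exact Or.inr ⟨y, c, hy, hd, hc, hlt⟩

lemma add_mul_dist_lt_of_lt_toENNReal_sub_div_edist {p : NNReal} (hz : E z ≠ ⊤)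
    (hbot : ∀ z, E z ≠ ⊥) (hne : z ≠ y) (h : p < (E z - E y).toENNReal / edist z y) :
    E y ≠ ⊤ ∧ (E y).toReal + p * dist z y < (E z).toReal := by
  have hy : E y ≠ ⊤ := by
    intro htop
    rw [htop, EReal.sub_top] at h
    simp at h
  rw [← EReal.coe_toReal hz (hbot _), ← EReal.coe_toReal hy (hbot _), ← EReal.coe_sub,
    EReal.toENNReal_of_ne_top (EReal.coe_ne_top _), EReal.toReal_coe,
    ENNReal.lt_div_iff_mul_lt (by simp [hne]) (by simp [edist_ne_top]), edist_dist,
    ← ENNReal.ofReal_coe_nnreal, ← ENNReal.ofReal_mul p.coe_nonneg,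
    ENNReal.ofReal_lt_ofReal_iff_of_nonneg (by positivity)] at h
  exact ⟨hy, by linarith⟩

lemma hasDescent_of_lt_metricSlope (κ : ℝ) (hbot : ∀ z, E z ≠ ⊥) (hz : E z ≠ ⊤)
    (h : q < metricSlope E z) : HasDescent E κ z q := by
  rw [metricSlope, if_neg hz] at h
  obtain ⟨p, hqp, hp⟩ := ENNReal.lt_iff_exists_nnreal_btwn.1 h
  have hcorr : ∀ᶠ y in 𝓝[≠] z, κ / 2 * dist z y < p - q := by
    refine nhdsWithin_le_nhds ((by fun_prop : Continuous fun y =>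
      κ / 2 * dist z y).continuousAt.eventually_lt_const ?_)
    simpa using hqp
  obtain ⟨y, hy, hlt, hne⟩ := ((frequently_lt_of_lt_limsup (by isBoundedDefault) hp).and_eventually
    (hcorr.and self_mem_nhdsWithin)).exists
  obtain ⟨hyt, hdec⟩ := add_mul_dist_lt_of_lt_toENNReal_sub_div_edist hz hbot (Ne.symm hne) hy
  have hd : 0 < dist z y := dist_pos.2 (Ne.symm hne)
  obtain ⟨c, hc, hcz⟩ := exists_between hdec
  refine Or.inr ⟨y, c, hyt, hd, ?_, by nlinarith⟩
  rw [← EReal.coe_toReal hz (hbot _)]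
  exact_mod_cast hcz

namespace IsIntegralEVI

lemma eventually_mul_le_dist (hu : IsIntegralEVI E κ u) (hκ : 0 ≤ κ)
    (hlsc : LowerSemicontinuous E) (hbot : ∀ z, E z ≠ ⊥) (h : HasDescent E κ (u 0) q) :
    ∀ᶠ η in 𝓝[>] (0 : ℝ), q * η ≤ dist (u η) (u 0) := by
  rcases h with rfl | ⟨y, c, hy, hd, hc, hlt⟩
  · simp
  have hstart : Tendsto u (𝓝[>] 0) (𝓝 (u 0)) :=
    (hu.continuousOn 0 self_mem_Ici).mono_left (nhdsWithin_mono _ Ioi_subset_Ici_self)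
  filter_upwards [hstart.eventually (hlsc (u 0) c hc), self_mem_nhdsWithin] with η hcη hη
  have hη : 0 < η := hη
  have hcη : c < (E (u η)).toReal := by
    rw [← EReal.coe_toReal (hu.ne_top η hη) (hbot _)] at hcη
    exact_mod_cast hcη
  have hevi := hu.dist_sq_le y 0 η hy le_rfl hη.le
  have hexp : Real.exp (κ * η) = κ * expIntegral κ η + 1 := by
    linarith [mul_expIntegral κ η]
  rw [sub_zero, hexp] at hevi
  have hJ : η ≤ expIntegral κ η := le_expIntegral hκ hη.le
  have hJ₀ : 0 ≤ expIntegral κ η := hη.le.trans hJ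
  set D := dist (u 0) y
  set J := expIntegral κ η
  have hdecrease : 2 * η * (q * D) ≤ D ^ 2 - dist (u η) y ^ 2 := by
    calc 2 * η * (q * D) ≤ 2 * J * (c - (E y).toReal - κ / 2 * D ^ 2) := by gcongr
      _ ≤ 2 * J * ((E (u η)).toReal - (E y).toReal - κ / 2 * D ^ 2) := by gcongr
      _ ≤ _ := by linarith
  have htri : D ≤ dist (u η) (u 0) + dist (u η) y := by
    rw [dist_comm (u η) (u 0)]
    exact dist_triangle _ _ _
  have hsq : D ^ 2 - dist (u η) y ^ 2 ≤ 2 * D * dist (u η) (u 0) := by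
    nlinarith [sq_nonneg (dist (u η) (u 0)), sq_nonneg (D - dist (u η) y),
      dist_nonneg (x := u η) (y := y), dist_nonneg (x := u η) (y := u 0)]
  exact le_of_mul_le_mul_left (by linarith) hd

/-- By contraction, the speed at time `s < T` is at least `exp (-κ (T - s))` times the speed at time
`T`. -/
lemma sq_mul_le_energy_sub (hu : IsIntegralEVI E κ u) (hκ : 0 ≤ κ) (hη : 0 < η)
    (h : q * η ≤ dist (u (T + η)) (u T)) (hs : 0 < s) (hsT : s + η ≤ T) :
    q ^ 2 * η ≤ 2 * Real.exp (3 * κ * T) * ((E (u s)).toReal - (E (u (s + η))).toReal) := by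
  have hcontr := (hu.shift hη.le).dist_le hu hκ hs.le (by linarith : s ≤ T)
  rw [add_comm η, add_comm η] at hcontr
  have hspeed : q * η ≤ Real.exp (κ * T) * dist (u (s + η)) (u s) :=
    h.trans (hcontr.trans (by gcongr; linarith))
  have hE := hu.energy_sub_nonneg hs (by linarith : s ≤ s + η)
  have hmove : dist (u (s + η)) (u s) ^ 2 ≤
      2 * (η * Real.exp (κ * T)) * ((E (u s)).toReal - (E (u (s + η))).toReal) := by
    have hevi := hu.dist_sq_le (u s) s (s + η) (hu.ne_top s hs) hs.le (by linarith)
    rw [dist_self, add_sub_cancel_left] at hevi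
    have hJ : expIntegral κ η ≤ η * Real.exp (κ * T) :=
      (expIntegral_le hκ hη.le).trans (by gcongr; linarith)
    calc dist (u (s + η)) (u s) ^ 2
        ≤ 2 * expIntegral κ η * ((E (u s)).toReal - (E (u (s + η))).toReal) := by linarith
      _ ≤ _ := by gcongr
  refine le_of_mul_le_mul_left ?_ hη
  calc η * (q ^ 2 * η) = (q * η) ^ 2 := by ring
    _ ≤ (Real.exp (κ * T) * dist (u (s + η)) (u s)) ^ 2 :=
        pow_le_pow_left₀ (by positivity) hspeed 2
    _ = Real.exp (κ * T) ^ 2 * dist (u (s + η)) (u s) ^ 2 := mul_pow _ _ _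
    _ ≤ Real.exp (κ * T) ^ 2 * (2 * (η * Real.exp (κ * T)) *
        ((E (u s)).toReal - (E (u (s + η))).toReal)) := by gcongr
    _ = _ := by
        rw [show 3 * κ * T = κ * T + κ * T + κ * T by ring, Real.exp_add, Real.exp_add]
        ring

lemma mul_sub_le_energy_sub (hu : IsIntegralEVI E κ u) (hκ : 0 ≤ κ)
    (hlsc : LowerSemicontinuous E) (hbot : ∀ z, E z ≠ ⊥) (h : HasDescent E κ (u T) q)
    (hr : 0 < r) (hrT : r ≤ T) :
    q ^ 2 * (T - r) ≤ 2 * Real.exp (3 * κ * T) * ((E (u r)).toReal - (E (u T)).toReal) := by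
  rcases hrT.eq_or_lt with rfl | hlt
  · simp
  have hspeed : ∀ᶠ η in 𝓝[>] (0 : ℝ), q * η ≤ dist (u (T + η)) (u T) := by
    simpa using (hu.shift (hr.le.trans hrT)).eventually_mul_le_dist hκ hlsc hbot (by simpa using h)
  have hη : Tendsto (fun n : ℕ => (T - r) / n) atTop (𝓝[>] 0) :=
    tendsto_nhdsWithin_iff.2 ⟨tendsto_const_div_atTop_nhds_zero_nat _,
      (eventually_gt_atTop 0).mono fun n hn =>
        div_pos (sub_pos.2 hlt) (Nat.cast_pos.2 hn)⟩
  obtain ⟨n, ⟨hn, hη₀⟩, hn₀⟩ := ((hη.eventually (hspeed.and self_mem_nhdsWithin)).and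
    (eventually_ne_atTop 0)).exists
  have hsum := le_of_forall_step_le (f := fun s =>
    2 * Real.exp (3 * κ * T) * (E (u s)).toReal + q ^ 2 * s) hrT hn₀ fun s hs hsT => by
      linarith [hu.sq_mul_le_energy_sub hκ hη₀ hn (hr.trans_le hs) hsT]
  linarith

/-- Add the inequalities on both halves of `[0, T]`: at time `T / 2` the energy still exceeds its
final value by the dissipation on `[T / 2, T]`. -/
lemma dist_sq_add_slope_le (hu : IsIntegralEVI E κ u) (hκ : 0 ≤ κ)
    (hlsc : LowerSemicontinuous E) (hbot : ∀ z, E z ≠ ⊥) (h : HasDescent E κ (u T) q)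
    (hT : 0 < T) (hy : E y ≠ ⊤) :
    dist (u T) y ^ 2 + Real.exp (-(3 * κ * T)) * (q ^ 2 * T ^ 2 / 4) ≤
      Real.exp (κ * T) * dist (u 0) y ^ 2 +
        2 * expIntegral κ T * ((E y).toReal - (E (u T)).toReal) := by
  obtain ⟨m, rfl⟩ : ∃ m, T = m + m := ⟨T / 2, (add_halves T).symm⟩
  have hm : 0 < m := by linarith
  have hfirst := hu.dist_sq_le y 0 m hy le_rfl hm.le
  have hsecond := hu.dist_sq_le y m (m + m) hy hm.le (by linarith)
  have hdiss := hu.mul_sub_le_energy_sub hκ hlsc hbot h hm (by linarith)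
  rw [sub_zero] at hfirst
  rw [add_sub_cancel_right] at hsecond hdiss
  have hexp : Real.exp (κ * (m + m)) = Real.exp (κ * m) * Real.exp (κ * m) := by
    rw [← Real.exp_add, mul_add]
  set P := Real.exp (3 * κ * (m + m)) with hP
  set e := Real.exp (κ * m)
  have he : 1 ≤ e := Real.one_le_exp (by positivity)
  have hweight : m ≤ e * expIntegral κ m := by
    nlinarith [le_expIntegral hκ hm.le]
  have hweight₀ : 0 ≤ e * expIntegral κ m := hm.le.trans hweight
  have hdiss' : P⁻¹ * (q ^ 2 * m) ≤ 2 * ((E (u m)).toReal - (E (u (m + m))).toReal) := by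
    rw [inv_mul_le_iff₀ (Real.exp_pos _)]
    linarith
  have hmain : P⁻¹ * (q ^ 2 * m ^ 2) ≤
      2 * e * expIntegral κ m * ((E (u m)).toReal - (E (u (m + m))).toReal) := by
    calc P⁻¹ * (q ^ 2 * m ^ 2) = m * (P⁻¹ * (q ^ 2 * m)) := by ring
      _ ≤ e * expIntegral κ m * (2 * ((E (u m)).toReal - (E (u (m + m))).toReal)) := by gcongr
      _ = _ := by ring
  rw [Real.exp_neg, ← hP, expIntegral_add_self, hexp]
  linear_combination e * hfirst + hsecond + hmain

lemma exp_mul_dist_sq_add_slope_le (hu : IsIntegralEVI E κ u) (hκ : 0 ≤ κ)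
    (hlsc : LowerSemicontinuous E) (hbot : ∀ z, E z ≠ ⊥) (h : HasDescent E κ (u T) q)
    (hT : 0 < T) (hy : E y ≠ ⊤) :
    Real.exp (-(4 * κ * T)) * (dist (u T) y ^ 2 + q ^ 2 * T ^ 2 / 4) ≤
      Real.exp (κ * T) * dist (u 0) y ^ 2 + 2 * T * ((E y).toReal - (E (u T)).toReal) := by
  set J := expIntegral κ T
  set e := (E y).toReal - (E (u T)).toReal
  have hTJ : T ≤ J := le_expIntegral hκ hT.le
  have hJ : 0 < J := hT.trans_le hTJ
  have hJT : J * Real.exp (-(κ * T)) ≤ T := by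
    rw [Real.exp_neg, ← div_eq_mul_inv, div_le_iff₀ (Real.exp_pos _)]
    exact expIntegral_le hκ hT.le
  have hevi := hu.dist_sq_add_slope_le hκ hlsc hbot h hT hy
  have hexp : Real.exp (-(4 * κ * T)) = Real.exp (-(κ * T)) * Real.exp (-(3 * κ * T)) := by
    rw [← Real.exp_add]
    ring_nf
  have hone : Real.exp (-(3 * κ * T)) ≤ 1 := Real.exp_le_one_iff.2 (by
    rw [neg_nonpos]
    positivity)
  refine le_of_mul_le_mul_left ?_ hJ
  calc J * (Real.exp (-(4 * κ * T)) * (dist (u T) y ^ 2 + q ^ 2 * T ^ 2 / 4))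
      = J * Real.exp (-(κ * T)) * (Real.exp (-(3 * κ * T)) * dist (u T) y ^ 2 +
        Real.exp (-(3 * κ * T)) * (q ^ 2 * T ^ 2 / 4)) := by
        rw [hexp]
        ring
    _ ≤ T * (1 * dist (u T) y ^ 2 + Real.exp (-(3 * κ * T)) * (q ^ 2 * T ^ 2 / 4)) := by gcongr
    _ ≤ T * (Real.exp (κ * T) * dist (u 0) y ^ 2 + 2 * J * e) := by
        rw [one_mul]
        gcongr
    _ = T * (Real.exp (κ * T) * dist (u 0) y ^ 2) + J * (2 * T * e) := by ring
    _ ≤ J * (Real.exp (κ * T) * dist (u 0) y ^ 2) + J * (2 * T * e) := by gcongr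
    _ = _ := by ring

end IsIntegralEVI
end Dissipation

/-! ### Regularization along the flow -/

/-- A family of integrated EVI flows `S z`, one from each point `z`. -/
structure IsIntegralFlow {X : Type*} [MetricSpace X] (E : X → EReal) (κ : ℝ) (S : X → ℝ → X) :
    Prop where
  zero : ∀ z, S z 0 = z
  isIntegralEVI : ∀ z, IsIntegralEVI E κ (S z)

section Comparison

variable {X : Type*} [MetricSpace X] {E : X → EReal} {κ h δ τ : ℝ} {u v : ℝ → X} {q : NNReal}

lemma IsIntegralEVI.exp_mul_dist_sq_add_slope_le_dist_start (hu : IsIntegralEVI E κ u)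
    (hv : IsIntegralEVI E κ v) (hκ : 0 ≤ κ) (hlsc : LowerSemicontinuous E) (hbot : ∀ z, E z ≠ ⊥)
    (hq : HasDescent E κ (v (h + δ)) q) (hh : 0 ≤ h) (hδ : 0 < δ) (hτ : h + δ ≤ τ)
    (hfin : E (u h) ≠ ⊤) :
    Real.exp (-(4 * κ * τ)) * (dist (u h) (v (h + δ)) ^ 2 + q ^ 2 * δ ^ 2 / 4) ≤
      Real.exp (2 * κ * τ) * dist (u 0) (v 0) ^ 2 +
        2 * δ * ((E (u h)).toReal - (E (v (h + δ))).toReal) := by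
  have hslope := (hv.shift hh).exp_mul_dist_sq_add_slope_le hκ hlsc hbot hq hδ hfin
  rw [add_zero, dist_comm _ (u h), dist_comm _ (u h)] at hslope
  have hcontr : dist (u h) (v h) ^ 2 ≤ (Real.exp (κ * h) * dist (u 0) (v 0)) ^ 2 := by
    gcongr
    simpa using hu.dist_le hv hκ le_rfl hh
  calc Real.exp (-(4 * κ * τ)) * (dist (u h) (v (h + δ)) ^ 2 + q ^ 2 * δ ^ 2 / 4)
      ≤ Real.exp (-(4 * κ * δ)) * (dist (u h) (v (h + δ)) ^ 2 + q ^ 2 * δ ^ 2 / 4) := by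
        gcongr
        linarith
    _ ≤ Real.exp (κ * δ) * (Real.exp (κ * h) * dist (u 0) (v 0)) ^ 2 +
        2 * δ * ((E (u h)).toReal - (E (v (h + δ))).toReal) := hslope.trans (by gcongr)
    _ = Real.exp (κ * δ + κ * h + κ * h) * dist (u 0) (v 0) ^ 2 +
        2 * δ * ((E (u h)).toReal - (E (v (h + δ))).toReal) := by
        rw [Real.exp_add, Real.exp_add]
        ring
    _ ≤ _ := by
        gcongr
        nlinarith [mul_nonneg hκ hδ.le, mul_le_mul_of_nonneg_left hτ hκ]

variable {S : X → ℝ → X} {z z' : X} {Δ K : ℝ}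

namespace IsIntegralFlow

lemma dist_sq_add_slope_le (hS : IsIntegralFlow E κ S) (hκ : 0 ≤ κ) (hlsc : LowerSemicontinuous E)
    (hbot : ∀ z, E z ≠ ⊥) (hτ : 0 < τ) (hh : 0 ≤ h) (hΔ : 0 ≤ Δ) (hle : h + τ * Δ ≤ τ)
    (hd : dist z z' ^ 2 ≤ Δ * K) (hq : HasDescent E κ (S z' (h + τ * Δ)) q)
    (hfin : E (S z h) ≠ ⊤) :
    dist (S z h) (S z' (h + τ * Δ)) ^ 2 + (τ / 2) ^ 2 * q ^ 2 * Δ ^ 2 ≤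
      Δ * (Real.exp (4 * κ * τ) * (Real.exp (2 * κ * τ) * K +
        2 * τ * ((E (S z h)).toReal - (E (S z' (h + τ * Δ))).toReal))) := by
  rcases hΔ.eq_or_lt with rfl | hΔ
  · obtain rfl : z = z' := by
      rw [zero_mul] at hd
      exact dist_eq_zero.1 (pow_eq_zero_iff two_ne_zero |>.1 (le_antisymm hd (sq_nonneg _)))
    simp
  have hcomp := (hS.isIntegralEVI z).exp_mul_dist_sq_add_slope_le_dist_start
    (hS.isIntegralEVI z') hκ hlsc hbot hq hh (mul_pos hτ hΔ) hle hfin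
  rw [hS.zero, hS.zero, Real.exp_neg, inv_mul_le_iff₀ (Real.exp_pos _)] at hcomp
  calc dist (S z h) (S z' (h + τ * Δ)) ^ 2 + (τ / 2) ^ 2 * q ^ 2 * Δ ^ 2
      = dist (S z h) (S z' (h + τ * Δ)) ^ 2 + q ^ 2 * (τ * Δ) ^ 2 / 4 := by ring
    _ ≤ Real.exp (4 * κ * τ) * (Real.exp (2 * κ * τ) * (Δ * K) +
        2 * (τ * Δ) * ((E (S z h)).toReal - (E (S z' (h + τ * Δ))).toReal)) :=
        hcomp.trans (by gcongr)
    _ = _ := by ring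

lemma continuous (hS : IsIntegralFlow E κ S) (hκ : 0 ≤ κ) {Y : Type*} [TopologicalSpace Y]
    {f : Y → X} {g : Y → ℝ} (hf : Continuous f) (hg : Continuous g) (hg₀ : ∀ y, 0 ≤ g y) :
    Continuous fun y => S (f y) (g y) := by
  refine continuous_iff_continuousAt.2 fun y => ?_
  have htime : Tendsto (fun y' => S (f y) (g y')) (𝓝 y) (𝓝 (S (f y) (g y))) :=
    ((hS.isIntegralEVI (f y)).continuousOn (g y) (hg₀ y)).tendsto.comp
      (tendsto_nhdsWithin_iff.2 ⟨hg.tendsto y, Eventually.of_forall hg₀⟩)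
  have hstart : Tendsto (fun y' => Real.exp (κ * g y') * dist (f y') (f y)) (𝓝 y) (𝓝 0) := by
    simpa using (by fun_prop : Continuous fun y' =>
      Real.exp (κ * g y') * dist (f y') (f y)).tendsto y
  have hsum := hstart.add (tendsto_iff_dist_tendsto_zero.1 htime)
  rw [add_zero] at hsum
  refine tendsto_iff_dist_tendsto_zero.2 (squeeze_zero (fun _ => dist_nonneg) (fun y' => ?_) hsum)
  refine (dist_triangle _ (S (f y) (g y')) _).trans (add_le_add_left ?_ _)
  simpa [hS.zero] using
    (hS.isIntegralEVI (f y')).dist_le (hS.isIntegralEVI (f y)) hκ le_rfl (hg₀ y')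

end IsIntegralFlow
end Comparison

lemma add_mul_sq_le_of_forall_lt {a b M m : ℝ≥0∞} (hb : b ≠ ⊤)
    (h : ∀ q : NNReal, q = 0 ∨ q < m → a + b * q ^ 2 ≤ M) : a + b * m ^ 2 ≤ M := by
  rcases eq_or_ne m 0 with rfl | hm
  · simpa using h 0 (Or.inl rfl)
  have : (𝓝[<] m).NeBot := nhdsLT_neBot_of_exists_lt ⟨0, pos_iff_ne_zero.2 hm⟩
  have hcont : Continuous fun q : ℝ≥0∞ => a + b * q ^ 2 :=
    continuous_const.add ((ENNReal.continuous_const_mul hb).comp (ENNReal.continuous_pow 2))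
  refine le_of_tendsto (x := 𝓝[<] m) ((hcont.tendsto m).mono_left nhdsWithin_le_nhds) ?_
  filter_upwards [self_mem_nhdsWithin] with q hq
  lift q to NNReal using ne_top_of_lt hq
  exact h q (Or.inr hq)

section RegularizedCurve

variable {X : Type*} [MetricSpace X] {E : X → EReal} {κ τ s t : ℝ} {S : X → ℝ → X}

/-- The curve `γ`, each point of which is evolved by the flow for the time `τ * min t (1 - t)`
(for `τ ≥ 0`), as a continuous family in `τ`. -/
def regularizedCurve (hS : IsIntegralFlow E κ S) (hκ : 0 ≤ κ) (γ : Curve X) : C(ℝ, Curve X) :=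
  ContinuousMap.curry ⟨fun p : ℝ × unitInterval =>
    S (γ p.2) (max p.1 0 * min (p.2 : ℝ) (1 - p.2)), hS.continuous hκ (by fun_prop) (by fun_prop)
      fun p => mul_nonneg (le_max_right _ _) (le_min p.2.2.1 (sub_nonneg.2 p.2.2.2))⟩

/-- The energy `E` along the extended regularized curve. -/
def regularizedEnergy (hS : IsIntegralFlow E κ S) (hκ : 0 ≤ κ) (γ : Curve X) (τ t : ℝ) : ℝ :=
  (E (curveExtend (regularizedCurve hS hκ γ τ) t)).toReal

/-- A control, in the sense of `HasEnergyBound`, of the regularized curve by a control `G` of the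
original one. The flow time increases on `[0, 1 / 2]` and decreases on `[1 / 2, 1]`, whence the
change of sign. -/
def regularizedBound (hS : IsIntegralFlow E κ S) (hκ : 0 ≤ κ) (γ : Curve X) (G : ℝ → ℝ)
    (τ t : ℝ) : ℝ :=
  Real.exp (4 * κ * τ) * (Real.exp (2 * κ * τ) * G t + 2 * τ *
    if t ≤ 1 / 2 then regularizedEnergy hS hκ γ τ (1 / 2) - regularizedEnergy hS hκ γ τ t
    else regularizedEnergy hS hκ γ τ t - regularizedEnergy hS hκ γ τ (1 / 2))

variable (hS : IsIntegralFlow E κ S) (hκ : 0 ≤ κ) {γ : Curve X} {G : ℝ → ℝ} {q : NNReal}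

lemma regularizedBound_of_le (G : ℝ → ℝ) (τ : ℝ) (ht : t ≤ 1 / 2) : regularizedBound hS hκ γ G τ t =
    Real.exp (4 * κ * τ) * (Real.exp (2 * κ * τ) * G t + 2 * τ *
      (regularizedEnergy hS hκ γ τ (1 / 2) - regularizedEnergy hS hκ γ τ t)) := by
  rw [regularizedBound, if_pos ht]

lemma regularizedBound_of_ge (G : ℝ → ℝ) (τ : ℝ) (ht : 1 / 2 ≤ t) : regularizedBound hS hκ γ G τ t =
    Real.exp (4 * κ * τ) * (Real.exp (2 * κ * τ) * G t + 2 * τ *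
      (regularizedEnergy hS hκ γ τ t - regularizedEnergy hS hκ γ τ (1 / 2))) := by
  rcases ht.eq_or_lt with rfl | ht
  · rw [regularizedBound, if_pos le_rfl, sub_self]
  · rw [regularizedBound, if_neg ht.not_ge]

lemma regularizedCurve_zero (γ : Curve X) : regularizedCurve hS hκ γ 0 = γ := by
  ext t
  simp [regularizedCurve, hS.zero]

lemma regularizedCurve_endpoints (γ : Curve X) (τ : ℝ) :
    regularizedCurve hS hκ γ τ 0 = γ 0 ∧ regularizedCurve hS hκ γ τ 1 = γ 1 := by
  simp [regularizedCurve, hS.zero]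

lemma curveExtend_regularizedCurve (γ : Curve X) (hτ : 0 ≤ τ) (ht : t ∈ Icc (0 : ℝ) 1) :
    curveExtend (regularizedCurve hS hκ γ τ) t = S (curveExtend γ t) (τ * min t (1 - t)) := by
  rw [curveExtend_of_mem _ ht, curveExtend_of_mem _ ht]
  simp [regularizedCurve, max_eq_left hτ]

lemma energy_regularizedCurve_ne_top (h₀ : E (γ 0) ≠ ⊤) (h₁ : E (γ 1) ≠ ⊤) (hτ : 0 < τ)
    (ht : t ∈ Icc (0 : ℝ) 1) : E (curveExtend (regularizedCurve hS hκ γ τ) t) ≠ ⊤ := by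
  rcases eq_endpoints_or_mem_Ioo_of_mem_Icc ht with rfl | rfl | ht'
  · rw [curveExtend_of_mem _ ht]
    exact (regularizedCurve_endpoints hS hκ γ τ).1 ▸ h₀
  · rw [curveExtend_of_mem _ ht]
    exact (regularizedCurve_endpoints hS hκ γ τ).2 ▸ h₁
  rw [curveExtend_regularizedCurve hS hκ γ hτ.le ht]
  exact (hS.isIntegralEVI _).ne_top _ (mul_pos hτ (lt_min ht'.1 (sub_pos.2 ht'.2)))

variable (hlsc : LowerSemicontinuous E) (hbot : ∀ z, E z ≠ ⊥) (h₀ : E (γ 0) ≠ ⊤)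
  (h₁ : E (γ 1) ≠ ⊤) (hG : HasEnergyBound (curveExtend γ) G (Icc 0 1)) (hτ : 0 < τ)

include hlsc hbot h₀ h₁ hG hτ

lemma dist_sq_regularizedCurve_le_of_le_half (hs : 0 ≤ s) (hst : s ≤ t) (ht : t ≤ 1 / 2)
    (hq : HasDescent E κ (curveExtend (regularizedCurve hS hκ γ τ) t) q) :
    dist (curveExtend (regularizedCurve hS hκ γ τ) s)
        (curveExtend (regularizedCurve hS hκ γ τ) t) ^ 2 + (τ / 2) ^ 2 * q ^ 2 * (t - s) ^ 2 ≤
      (t - s) * (regularizedBound hS hκ γ G τ t - regularizedBound hS hκ γ G τ s) := by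
  have hs' : s ∈ Icc (0 : ℝ) 1 := ⟨hs, by linarith⟩
  have ht' : t ∈ Icc (0 : ℝ) 1 := ⟨hs.trans hst, by linarith⟩
  have hadd : τ * s + τ * (t - s) = τ * t := by ring
  have hfin := energy_regularizedCurve_ne_top hS hκ h₀ h₁ hτ hs'
  have hflow_s := curveExtend_regularizedCurve hS hκ γ hτ.le hs'
  have hflow_t := curveExtend_regularizedCurve hS hκ γ hτ.le ht'
  rw [min_eq_left (by linarith)] at hflow_s hflow_t
  have hcomp := hS.dist_sq_add_slope_le (h := τ * s) (Δ := t - s) (q := q) hκ hlsc hbot hτ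
    (by positivity) (sub_nonneg.2 hst) (by rw [hadd]; nlinarith) (hG s hs' t ht' hst)
    (by rwa [hadd, ← hflow_t]) (by rwa [← hflow_s])
  rw [hadd, ← hflow_s, ← hflow_t] at hcomp
  rw [regularizedBound_of_le hS hκ G τ ht, regularizedBound_of_le hS hκ G τ (hst.trans ht)]
  refine hcomp.trans (le_of_eq ?_)
  unfold regularizedEnergy
  ring

lemma dist_sq_regularizedCurve_le_of_half_le (hs : 1 / 2 ≤ s) (hst : s ≤ t) (ht : t ≤ 1)
    (hq : HasDescent E κ (curveExtend (regularizedCurve hS hκ γ τ) s) q) :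
    dist (curveExtend (regularizedCurve hS hκ γ τ) s)
        (curveExtend (regularizedCurve hS hκ γ τ) t) ^ 2 + (τ / 2) ^ 2 * q ^ 2 * (t - s) ^ 2 ≤
      (t - s) * (regularizedBound hS hκ γ G τ t - regularizedBound hS hκ γ G τ s) := by
  have hs' : s ∈ Icc (0 : ℝ) 1 := ⟨by linarith, hst.trans ht⟩
  have ht' : t ∈ Icc (0 : ℝ) 1 := ⟨by linarith, ht⟩
  have hadd : τ * (1 - t) + τ * (t - s) = τ * (1 - s) := by ring
  have hfin := energy_regularizedCurve_ne_top hS hκ h₀ h₁ hτ ht'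
  have hflow_s := curveExtend_regularizedCurve hS hκ γ hτ.le hs'
  have hflow_t := curveExtend_regularizedCurve hS hκ γ hτ.le ht'
  rw [min_eq_right (by linarith)] at hflow_s hflow_t
  have hcomp := hS.dist_sq_add_slope_le (h := τ * (1 - t)) (Δ := t - s) (q := q) hκ hlsc hbot hτ
    (mul_nonneg hτ.le (sub_nonneg.2 ht)) (sub_nonneg.2 hst) (by rw [hadd]; nlinarith)
    (by rw [dist_comm]; exact hG s hs' t ht' hst)
    (by rwa [hadd, ← hflow_s]) (by rwa [← hflow_t])
  rw [hadd, ← hflow_s, ← hflow_t, dist_comm] at hcomp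
  rw [regularizedBound_of_ge hS hκ G τ hs, regularizedBound_of_ge hS hκ G τ (hs.trans hst)]
  refine hcomp.trans (le_of_eq ?_)
  unfold regularizedEnergy
  ring

lemma hasEnergyBound_regularizedCurve : HasEnergyBound (curveExtend (regularizedCurve hS hκ γ τ))
    (regularizedBound hS hκ γ G τ) (Icc 0 1) := by
  refine HasEnergyBound.union_Icc (b := 1 / 2) (fun s hs t ht hst => ?_) fun s hs t ht hst => ?_
  · simpa using dist_sq_regularizedCurve_le_of_le_half (q := 0) hS hκ hlsc hbot h₀ h₁ hG hτ hs.1 hst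
      ht.2 (Or.inl rfl)
  · simpa using dist_sq_regularizedCurve_le_of_half_le (q := 0) hS hκ hlsc hbot h₀ h₁ hG hτ hs.1 hst
      ht.2 (Or.inl rfl)

lemma eventually_dist_sq_regularizedCurve_le (ht : t ∈ Ioo (0 : ℝ) 1) (hhalf : t ≠ 1 / 2)
    (hq : HasDescent E κ (curveExtend (regularizedCurve hS hκ γ τ) t) q) :
    ∀ᶠ s in 𝓝 t, dist (curveExtend (regularizedCurve hS hκ γ τ) s)
        (curveExtend (regularizedCurve hS hκ γ τ) t) ^ 2 + (τ / 2) ^ 2 * q ^ 2 * (s - t) ^ 2 ≤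
      (s - t) * (regularizedBound hS hκ γ G τ s - regularizedBound hS hκ γ G τ t) := by
  have hcont : Continuous (curveExtend (regularizedCurve hS hκ γ τ)) :=
    (regularizedCurve hS hκ γ τ).continuous.Icc_extend'
  have hside : ∀ᶠ s in 𝓝 t, s < 1 / 2 ∧ t < 1 / 2 ∨ 1 / 2 < s ∧ 1 / 2 < t := by
    rcases hhalf.lt_or_gt with h | h
    · exact (gt_mem_nhds h).mono fun s hs => Or.inl ⟨hs, h⟩
    · exact (lt_mem_nhds h).mono fun s hs => Or.inr ⟨hs, h⟩
  filter_upwards [Ioo_mem_nhds ht.1 ht.2, hside,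
    hcont.continuousAt.eventually (hq.eventually hlsc)] with s hs hside hqs
  rcases hside with ⟨hs', ht'⟩ | ⟨hs', ht'⟩ <;> rcases le_total s t with hst | hst
  · linarith [dist_sq_regularizedCurve_le_of_le_half hS hκ hlsc hbot h₀ h₁ hG hτ hs.1.le hst
      ht'.le hq]
  · rw [dist_comm]
    exact dist_sq_regularizedCurve_le_of_le_half hS hκ hlsc hbot h₀ h₁ hG hτ ht.1.le hst hs'.le hqs
  · linarith [dist_sq_regularizedCurve_le_of_half_le hS hκ hlsc hbot h₀ h₁ hG hτ hs'.le hst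
      ht.2.le hqs]
  · rw [dist_comm]
    exact dist_sq_regularizedCurve_le_of_half_le hS hκ hlsc hbot h₀ h₁ hG hτ ht'.le hst hs.2.le hq

lemma metricSpeed_sq_add_metricSlope_sq_le (ht : t ∈ Ioo (0 : ℝ) 1) (hhalf : t ≠ 1 / 2)
    (hd : DifferentiableAt ℝ (regularizedBound hS hκ γ G τ) t) :
    metricSpeed (curveExtend (regularizedCurve hS hκ γ τ)) t ^ 2 + ENNReal.ofReal ((τ / 2) ^ 2) *
        metricSlope E (curveExtend (regularizedCurve hS hκ γ τ) t) ^ 2 ≤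
      ENNReal.ofReal (deriv (regularizedBound hS hκ γ G τ) t) := by
  refine add_mul_sq_le_of_forall_lt ENNReal.ofReal_ne_top fun q hq => ?_
  have hdesc : HasDescent E κ (curveExtend (regularizedCurve hS hκ γ τ) t) q :=
    hq.elim Or.inl (hasDescent_of_lt_metricSlope κ hbot
      (energy_regularizedCurve_ne_top hS hκ h₀ h₁ hτ (Ioo_subset_Icc_self ht)))
  have hspeed := metricSpeed_sq_add_le (c := (τ / 2) ^ 2 * q ^ 2) (by positivity) hd
    (nhdsWithin_le_nhds
      (eventually_dist_sq_regularizedCurve_le hS hκ hlsc hbot h₀ h₁ hG hτ ht hhalf hdesc))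
  rwa [ENNReal.ofReal_mul (by positivity), ENNReal.ofReal_pow q.coe_nonneg,
    ENNReal.ofReal_coe_nnreal] at hspeed

lemma schrodingerAction_regularizedCurve_le {p : unitInterval} (hp : (p : ℝ) = 1 / 2) :
    schrodingerAction E (τ / 2) (regularizedCurve hS hκ γ τ) ≤ 1 / 2 * ENNReal.ofReal
      (Real.exp (4 * κ * τ) * (Real.exp (2 * κ * τ) * (G 1 - G 0) + 2 * τ *
        ((E (γ 0)).toReal + (E (γ 1)).toReal -
          2 * (E (regularizedCurve hS hκ γ τ p)).toReal))) := by
  have hbound := hasEnergyBound_regularizedCurve hS hκ hlsc hbot h₀ h₁ hG hτ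
  have hint := lintegral_le_of_le_deriv zero_le_one hbound.monotoneOn
    (g := fun t => metricSpeed (curveExtend (regularizedCurve hS hκ γ τ)) t ^ 2 +
      ENNReal.ofReal ((τ / 2) ^ 2) *
        metricSlope E (curveExtend (regularizedCurve hS hκ γ τ) t) ^ 2)
    ((Measure.ae_ne volume (1 / 2 : ℝ)).mono fun t hhalf ht hd =>
      metricSpeed_sq_add_metricSlope_sq_le hS hκ hlsc hbot h₀ h₁ hG hτ ht hhalf hd)
  have henergy (r : unitInterval) : regularizedEnergy hS hκ γ τ r =
      (E (regularizedCurve hS hκ γ τ r)).toReal := by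
    rw [regularizedEnergy, curveExtend_of_mem _ r.2]
  have henergy_zero := henergy 0
  have henergy_one := henergy 1
  have henergy_half := hp ▸ henergy p
  rw [(regularizedCurve_endpoints hS hκ γ τ).1, Set.Icc.coe_zero] at henergy_zero
  rw [(regularizedCurve_endpoints hS hκ γ τ).2, Set.Icc.coe_one] at henergy_one
  rw [schrodingerAction, kineticAction, if_pos (hbound.absolutelyContinuousOnInterval zero_le_one),
    fisherInformation, mul_left_comm, ← mul_add, ← lintegral_const_mul' _ _ ENNReal.ofReal_ne_top]
  gcongr 1 / 2 * ?_
  refine (le_lintegral_add _ _).trans (hint.trans (ENNReal.ofReal_le_ofReal (le_of_eq ?_)))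
  rw [regularizedBound_of_ge hS hκ G τ (by norm_num),
    regularizedBound_of_le hS hκ G τ (by norm_num), henergy_zero, henergy_one, henergy_half]
  ring

end RegularizedCurve

section Recovery

variable {X : Type*} [MetricSpace X] {E : X → EReal} {x y : X} {γ : Curve X}

lemma exists_isIntegralFlow {lam : ℝ} (hlsc : LowerSemicontinuous E) (hbot : ∀ z, E z ≠ ⊥)
    (hflow : ∀ z, ∃ u, IsEVIFlowFrom E lam u z) (hy : E y ≠ ⊤) :
    ∃ S, IsIntegralFlow E |lam| S := by
  have hv : ∀ z, ∃ v, v 0 = z ∧ IsIntegralEVI E |lam| v := fun z => by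
    obtain ⟨u, hu⟩ := hflow z
    simpa using (hu.mono (neg_abs_le lam)).exists_isIntegralEVI hlsc hbot hy
  choose S hS₀ hS using hv
  exact ⟨S, hS₀, hS⟩

lemma tendsto_half_mul_ofReal_exp_mul (κ M : ℝ) {a : ℝ≥0∞} (ha : a ≠ ⊤) :
    Tendsto (fun τ => 1 / 2 * ENNReal.ofReal (Real.exp (4 * κ * τ) *
      (Real.exp (2 * κ * τ) * (2 * a.toReal) + 2 * τ * M))) (𝓝 0) (𝓝 a) := by
  have hcont : Continuous fun τ : ℝ =>
    Real.exp (4 * κ * τ) * (Real.exp (2 * κ * τ) * (2 * a.toReal) + 2 * τ * M) := by fun_prop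
  have hzero : 1 / 2 * ENNReal.ofReal (2 * a.toReal) = a := by
    rw [ENNReal.ofReal_mul two_pos.le, ENNReal.ofReal_toReal ha, ← mul_assoc]
    simp [ENNReal.inv_mul_cancel]
  have hlim := ENNReal.Tendsto.const_mul (a := 1 / 2) (ENNReal.tendsto_ofReal (hcont.tendsto 0))
    (Or.inr (by simp))
  simp only [mul_zero, Real.exp_zero, one_mul, zero_mul, add_zero, hzero] at hlim
  exact hlim

lemma exists_recovery (hlsc : LowerSemicontinuous E) (hbot : ∀ z, E z ≠ ⊥)
    (hflow : ∃ lam, ∀ z, ∃ u, IsEVIFlowFrom E lam u z) (h₀ : E (γ 0) ≠ ⊤) (h₁ : E (γ 1) ≠ ⊤)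
    (hA : kineticAction γ ≠ ⊤) :
    ∃ γs : ℝ → Curve X, Tendsto γs (𝓝[>] 0) (𝓝 γ) ∧ (∀ ε, γs ε 0 = γ 0 ∧ γs ε 1 = γ 1) ∧
      limsup (fun ε => schrodingerAction E ε (γs ε)) (𝓝[>] 0) ≤ kineticAction γ := by
  obtain ⟨lam, hflow⟩ := hflow
  obtain ⟨S, hS⟩ := exists_isIntegralFlow hlsc hbot hflow h₀
  obtain ⟨G, hG, hG₀, hG₁⟩ := exists_hasEnergyBound_of_kineticAction_ne_top hA
  set κ := |lam|
  have hκ : 0 ≤ κ := abs_nonneg lam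
  set γs : ℝ → Curve X := fun ε => regularizedCurve hS hκ γ (2 * ε)
  have hlim : Tendsto γs (𝓝[>] 0) (𝓝 γ) := by
    have hcont : Continuous γs :=
      (regularizedCurve hS hκ γ).continuous.comp (continuous_const_mul 2)
    simpa [γs, regularizedCurve_zero] using (hcont.tendsto 0).mono_left nhdsWithin_le_nhds
  refine ⟨γs, hlim, fun ε => regularizedCurve_endpoints hS hκ γ _, ?_⟩
  obtain ⟨p, hp⟩ : ∃ p : unitInterval, (p : ℝ) = 1 / 2 := ⟨⟨1 / 2, by norm_num, by norm_num⟩, rfl⟩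
  obtain ⟨c, hc⟩ : ∃ c : ℝ, (c : EReal) < E (γ p) := by
    obtain ⟨c, -, hc⟩ := EReal.lt_iff_exists_real_btwn.1 (bot_lt_iff_ne_bot.2 (hbot (γ p)))
    exact ⟨c, hc⟩
  have hbound : Tendsto (fun ε => 1 / 2 * ENNReal.ofReal (Real.exp (4 * κ * (2 * ε)) *
      (Real.exp (2 * κ * (2 * ε)) * (2 * (kineticAction γ).toReal) + 2 * (2 * ε) *
        ((E (γ 0)).toReal + (E (γ 1)).toReal - 2 * c)))) (𝓝[>] 0) (𝓝 (kineticAction γ)) := by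
    refine (tendsto_half_mul_ofReal_exp_mul κ _ hA).comp (Tendsto.mono_left ?_ nhdsWithin_le_nhds)
    simpa using (continuous_const_mul (2 : ℝ)).tendsto 0
  rw [← hbound.limsup_eq]
  refine limsup_le_limsup ?_
  filter_upwards [(((continuous_eval_const p).tendsto γ).comp hlim).eventually (hlsc _ c hc),
    self_mem_nhdsWithin] with ε hcε hε
  have hτ : 0 < 2 * ε := mul_pos two_pos hε
  have hfin : E (γs ε p) ≠ ⊤ := by
    simpa only [curveExtend_of_mem _ p.2] using energy_regularizedCurve_ne_top hS hκ h₀ h₁ hτ p.2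
  have hcε : (c : EReal) < E (γs ε p) := hcε
  have hcε' : c ≤ (E (γs ε p)).toReal := by
    rw [← EReal.coe_toReal hfin (hbot _)] at hcε
    exact_mod_cast hcε.le
  have haction := schrodingerAction_regularizedCurve_le hS hκ hlsc hbot h₀ h₁ hG hτ hp
  rw [mul_div_cancel_left₀ ε two_ne_zero, hG₀, hG₁, sub_zero] at haction
  exact haction.trans (by gcongr)

lemma exists_recovery_endpointIndicator (hlsc : LowerSemicontinuous E) (hbot : ∀ z, E z ≠ ⊥)
    (hflow : ∃ lam, ∀ z, ∃ u, IsEVIFlowFrom E lam u z) (hx : E x ≠ ⊤) (hy : E y ≠ ⊤)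
    (γ : Curve X) :
    ∃ γs : ℝ → Curve X, Tendsto γs (𝓝[>] 0) (𝓝 γ) ∧
      limsup (fun ε => schrodingerAction E ε (γs ε) + endpointIndicator x y (γs ε)) (𝓝[>] 0) ≤
        kineticAction γ + endpointIndicator x y γ := by
  by_cases hfin : kineticAction γ + endpointIndicator x y γ = ⊤
  · exact ⟨fun _ => γ, tendsto_const_nhds, hfin ▸ le_top⟩
  obtain ⟨hA, hι⟩ := ENNReal.add_ne_top.1 hfin
  obtain ⟨rfl, rfl⟩ : γ 0 = x ∧ γ 1 = y := not_not.1 fun h => hι (if_neg h)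
  obtain ⟨γs, hlim, hends, hle⟩ := exists_recovery hlsc hbot hflow hx hy hA
  refine ⟨γs, hlim, ?_⟩
  simpa only [endpointIndicator, hends, and_self, if_true, add_zero] using hle

end Recovery

lemma IsAdmissible.ne_bot {X : Type*} [MetricSpace X] {E : X → EReal} (hE : IsAdmissible E)
    (z : X) : E z ≠ ⊥ := by
  obtain ⟨c, hc⟩ := hE.bddBelow {z} Bornology.isBounded_singleton
  exact ((EReal.bot_lt_coe c).trans_le (hc z rfl)).ne'

end SchrodingerGamma

end

theorem theorem4p3_general {X : Type*} [MetricSpace X] (E : X → EReal)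
    (hlsc : LowerSemicontinuous E) (hbot : ∀ z, E z ≠ ⊥)
    (hflow : ∃ lam : ℝ, ∀ z : X, ∃ γ : ℝ → X, SchrodingerGamma.IsEVIFlowFrom E lam γ z)
    (x y : X) (hx : E x < ⊤) (hy : E y < ⊤) :
    SchrodingerGamma.GammaConverges (SchrodingerGamma.uniformTopology X)
        (fun ε γ => SchrodingerGamma.schrodingerAction E ε γ
          + SchrodingerGamma.endpointIndicator x y γ)
        (fun γ => SchrodingerGamma.kineticAction γ
          + SchrodingerGamma.endpointIndicator x y γ) ∧
      ∀ σ : TopologicalSpace X,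
        (∀ u : ℕ → X, Bornology.IsBounded (Set.range u) →
          ∃ (z : X) (φ : ℕ → ℕ), StrictMono φ ∧ Tendsto (u ∘ φ) atTop (@nhds X σ z)) →
        (∀ (u v : ℕ → X) (a b : X), Tendsto u atTop (@nhds X σ a) →
          Tendsto v atTop (@nhds X σ b) →
          edist a b ≤ liminf (fun n => edist (u n) (v n)) atTop) →
        SchrodingerGamma.GammaConverges (SchrodingerGamma.pointwiseTopology σ)
          (fun ε γ => SchrodingerGamma.schrodingerAction E ε γ
            + SchrodingerGamma.endpointIndicator x y γ)
          (fun γ => SchrodingerGamma.kineticAction γ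
            + SchrodingerGamma.endpointIndicator x y γ) := by
  have hrec := SchrodingerGamma.exists_recovery_endpointIndicator hlsc hbot hflow hx.ne hy.ne
  refine ⟨⟨fun ε _ _ _ _ h => SchrodingerGamma.action_le_liminf_of_tendsto_uniform E x y ε h, hrec⟩,
    fun σ hcompact hdist => ⟨fun ε _ _ _ _ h =>
      SchrodingerGamma.action_le_liminf_of_tendsto_pointwise σ E x y hdist ε h, fun γ => ?_⟩⟩
  obtain ⟨γs, hlim, hle⟩ := hrec γ
  exact ⟨γs, SchrodingerGamma.tendsto_pointwiseTopology hlim hcompact hdist, hle⟩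

theorem theorem4p3 {X : Type*} [MetricSpace X] [CompleteSpace X]
    [TopologicalSpace.SeparableSpace X] (E : X → EReal) (hE : SchrodingerGamma.IsAdmissible E)
    (x y : X) (hx : E x < ⊤) (hy : E y < ⊤) :
    SchrodingerGamma.GammaConverges (SchrodingerGamma.uniformTopology X)
        (fun ε γ => SchrodingerGamma.schrodingerAction E ε γ
          + SchrodingerGamma.endpointIndicator x y γ)
        (fun γ => SchrodingerGamma.kineticAction γ
          + SchrodingerGamma.endpointIndicator x y γ) ∧
      ∀ σ : TopologicalSpace X, SchrodingerGamma.IsCompatible E σ →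
        SchrodingerGamma.GammaConverges (SchrodingerGamma.pointwiseTopology σ)
          (fun ε γ => SchrodingerGamma.schrodingerAction E ε γ
            + SchrodingerGamma.endpointIndicator x y γ)
          (fun γ => SchrodingerGamma.kineticAction γ
            + SchrodingerGamma.endpointIndicator x y γ) := by
  obtain ⟨huniform, hpointwise⟩ :=
    theorem4p3_general E hE.lsc hE.ne_bot hE.exists_flow x y hx hy
  exact ⟨huniform, fun σ hσ => hpointwise σ hσ.seqCompact hσ.dist_lsc⟩
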